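/- Let $\mathcal X,\hat{\mathcal X}$ be finite alphabets, let $X$ be a discrete memoryless source with distribution $P_X$ on $\mathcal X$, let $d:\mathcal X\times\hat{\mathcal X}\to[0,\infty)$ be a distortion measure, extended to sequences by $\hat d(x^n,\hat x^n)=\frac1n\sum_{i=1}^n d(x_i,\hat x_i)$, and let $D$ be a distortion level for which some conditional distribution $P_{\hat X|X}$ satisfies $\mathbb E\,d(X,\hat X)\le D$. Then the minimum $$R(D)=\min_{P_{\hat X|X}:\ \mathbb E d(X,\hat X)\le D} I(X;\hat X)$$ exists, and nested linear codes over prime fields achieve it, in the following sense. Let $P_{\hat X|X}$ attain the minimum and let $q\ge|\hat{\mathcal X}|$ be a prime. Then $\hat{\mathcal X}$ can be embedded in $\mathbb Z_q$ so that $\hat X$ is not almost surely $0$, and for every block length $n$ there are matrices $H_1$ ($k_1(n)\times n$) and $H_2=\begin{bmatrix}H_1\\ \Delta H\end{bmatrix}$ ($k_2(n)\times n$) over $\mathbb Z_q$, i.e. nested linear codes $\mathcal C_2=\ker H_2\subseteq\mathcal C_1=\ker H_1\subseteq\mathbb Z_q^n$, such that: (a) $\mathcal C_1$ is a good source code for $P_{X\hat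 X}$: for every $\epsilon>0$ and all large $n$, with probability at least $1-\epsilon$ there is a word of $\mathcal C_1$ that is jointly strongly $\epsilon$-typical with $X^n$; and $\lim_n\frac{k_1(n)}n\log q=H(\hat X|X)$. (b) $\mathcal C_2$ is a good channel code for $P_{\hat X}$ (without side information): for every $\epsilon>0$ and all large $n$ there is $\delta\in(0,\epsilon]$ such that an i.i.d. sequence $\hat X^n\sim P_{\hat X}^n$ is strongly $\delta$-typical with probability at least $1-\epsilon$ and, with probability at most $\epsilon$, some other strongly $\delta$-typical sequence has the same syndrome $H_2\hat X^n$; moreover a decoder recovers $\hat X^n$ from $H_2\hat X^n$ with probability at least $1-\epsilon$; and $\lim_n\frac{k_2(n)}n\log q=H(\hat X)$. (c) There is an encoder that quantizes $X^n$ to a word $u^n\in\mathcal C_1$ and sends the coset of $\mathcal C_2$ in $\mathcal C_1$ containing $u^n$ (as the syndrome $\Delta H u^n\in\mathbb Z_q^{k_2-k_1}$), and a decoder that outputs a leader, in $\mathcal C_1$, of that coset, read in $\hat{\mathcal X}$ through a map $\mathbb Z_q\to\hat{\mathcal X}$ that is a left inverse of the embedding, such that for every $\epsilon>0$ and all large $n$: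 with probability at least $1-\epsilon$ the word $u^n$ is jointly strongly $\epsilon$-typical with $X^n$ and the leader equals $u^n$; and the expected distortion is at most $D+\epsilon$. The rate satisfies $\lim_n\frac{k_2(n)-k_1(n)}n\log q=R(D)$. -/

import Mathlib

open Filter Topology

namespace NestedCodes

noncomputable section

/-! ### Finite distributions and information quantities

Distributions on a finite alphabet are real functions (elements of the standard simplex).
All logarithms are natural, in the entropies and in the rates alike, so that the base is
immaterial. -/

section Information

variable {α β γ : Type*}

/-- First marginal of a joint distribution. -/
def margFst [Fintype β] (J : α × β → ℝ) (a : α) : ℝ := ∑ b, J (a, b)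

/-- Second marginal of a joint distribution. -/
def margSnd [Fintype α] (J : α × β → ℝ) (b : β) : ℝ := ∑ a, J (a, b)

/-- Shannon entropy `H(p) = - ∑ p log p`, with `0 log 0 = 0`. -/
def entropy [Fintype α] (p : α → ℝ) : ℝ := ∑ a, Real.negMulLog (p a)

/-- Conditional entropy `H(B | A) = - ∑ J(a,b) log (J(a,b) / J_A(a))` of the second coordinate
given the first. -/
def condEntropy [Fintype α] [Fintype β] (J : α × β → ℝ) : ℝ :=
  ∑ a, ∑ b, -(J (a, b) * Real.log (J (a, b) / margFst J a))

/-- Mutual information `I(A ; B) = ∑ J(a,b) log (J(a,b) / (J_A(a) J_B(b)))`. -/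
def mutualInfo [Fintype α] [Fintype β] (J : α × β → ℝ) : ℝ :=
  ∑ a, ∑ b, J (a, b) * Real.log (J (a, b) / (margFst J a * margSnd J b))

/-- Joint distribution of an input with distribution `P` and the output of the channel `W`. -/
def joint (P : α → ℝ) (W : α → β → ℝ) : α × β → ℝ := fun z => P z.1 * W z.1 z.2

/-- Relabelling of the second coordinate: the law of `(A, e(B))` if `(A, B)` has law `J`. -/
def relabelSnd [Fintype β] [DecidableEq γ] (e : β → γ) (J : α × β → ℝ) : α × γ → ℝ :=
  fun z => ∑ b, if e b = z.2 then J (z.1, b) else 0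

/-- The `n`-fold product distribution of `P`, evaluated on a set of sequences. -/
def blockProb [Fintype α] (P : α → ℝ) {n : ℕ} (A : Set (Fin n → α)) : ℝ :=
  ∑ x, A.indicator (fun x => ∏ i, P (x i)) x

/-- Strong `ε`-typicality: every letter has relative frequency within `ε` of its probability,
and no letter of probability zero occurs. -/
def IsTypical (p : α → ℝ) (ε : ℝ) {n : ℕ} (x : Fin n → α) : Prop :=
  ∀ a, |(({i | x i = a} : Set (Fin n)).ncard : ℝ) / n - p a| ≤ ε ∧ (p a = 0 → ∀ i, x i ≠ a)

end Information

/-! ### The Shannon rate-distortion function -/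

section RateDistortion

variable {X Y : Type*} [Fintype X] [Fintype Y]

/-- `W` is a test channel (a conditional distribution on `Y` given `X`) such that the expected
distortion under the input distribution `P` is at most `D`. -/
def IsFeasible (P : X → ℝ) (d : X → Y → ℝ) (D : ℝ) (W : X → Y → ℝ) : Prop :=
  (∀ x, W x ∈ stdSimplex ℝ Y) ∧ ∑ x, ∑ y, joint P W (x, y) * d x y ≤ D

/-- The values of the mutual information over all feasible test channels. -/
def feasibleRates (P : X → ℝ) (d : X → Y → ℝ) (D : ℝ) : Set ℝ :=
  {r | ∃ W, IsFeasible P d D W ∧ r = mutualInfo (joint P W)}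

/-- The rate-distortion function `R(D)`. -/
def rateDistortion (P : X → ℝ) (d : X → Y → ℝ) (D : ℝ) : ℝ := sInf (feasibleRates P d D)

end RateDistortion

/-! ### Linear codes and their goodness -/

/-- The linear code of block length `n` over `ℤ/q` with parity-check matrix `H`. -/
def code {q n k : ℕ} (H : Matrix (Fin k) (Fin n) (ZMod q)) :
    Submodule (ZMod q) (Fin n → ZMod q) :=
  LinearMap.ker H.mulVecLin

/-- For `q` prime: a distribution on `ℤ/q` which is not concentrated on `0`. -/
def NonRedundant {q : ℕ} (p : ZMod q → ℝ) : Prop := ∃ u, u ≠ 0 ∧ 0 < p u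

section Good

variable {q : ℕ} [NeZero q]

/-- The source sequences for which the code contains a jointly `ε`-typical codeword. -/
def coveredSet {X : Type*} (J : X × ZMod q → ℝ) (ε : ℝ) {n : ℕ}
    (C : Submodule (ZMod q) (Fin n → ZMod q)) : Set (Fin n → X) :=
  {x | ∃ u ∈ C, IsTypical J ε (fun i => (x i, u i))}

/-- A sequence of linear codes (one for each block length, given by parity-check matrices) is a
good source code for the joint distribution `J` of `(X, U)`. -/
def IsGoodSourceCode {X : Type*} [Fintype X] (J : X × ZMod q → ℝ) {k : ℕ → ℕ}
    (H : ∀ n, Matrix (Fin (k n)) (Fin n) (ZMod q)) : Prop :=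
  NonRedundant (margSnd J) ∧
  ∀ ε : ℝ, 0 < ε → ∀ᶠ n in atTop, 1 - ε ≤ blockProb (margFst J) (coveredSet J ε (code (H n)))

/-- The pairs `(z, s)` for which some other sequence, jointly `ε`-typical with `s`, has the same
syndrome as `z`. -/
def confusableSet {S : Type*} (J : ZMod q × S → ℝ) (ε : ℝ) {n k : ℕ}
    (H : Matrix (Fin k) (Fin n) (ZMod q)) : Set (Fin n → ZMod q × S) :=
  {zs | ∃ z' : Fin n → ZMod q, z' ≠ (fun i => (zs i).1) ∧
    IsTypical J ε (fun i => (z' i, (zs i).2)) ∧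
    H.mulVec z' = H.mulVec (fun i => (zs i).1)}

/-- A sequence of linear codes is a good channel code for the joint distribution `J` of `(Z, S)`.
For every `ε` and every large `n`, there is a tolerance `δ ≤ ε` such that `(Z^n, S^n)` is
`δ`-typical and not confusable at tolerance `δ`, up to probability `ε`; and there is a decoder
which recovers `Z^n` from its syndrome and `S^n` up to probability `ε`.

The tolerance has to be allowed to tend to zero with `n`: in general, at a fixed tolerance the number of
typical sequences exceeds `exp (n H(Z|S))` by an exponential factor, so that no code whose number
of syndromes is `exp (n H(Z|S) + o(n))` could avoid confusion. -/
def IsGoodChannelCode {S : Type*} [Fintype S] (J : ZMod q × S → ℝ) {k : ℕ → ℕ}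
    (H : ∀ n, Matrix (Fin (k n)) (Fin n) (ZMod q)) : Prop :=
  NonRedundant (margFst J) ∧
  ∀ ε : ℝ, 0 < ε → ∀ᶠ n in atTop,
    (∃ δ : ℝ, 0 < δ ∧ δ ≤ ε ∧
      1 - ε ≤ blockProb J {zs : Fin n → ZMod q × S | IsTypical J δ zs} ∧
      blockProb J (confusableSet J δ (H n)) ≤ ε) ∧
    ∃ ψ : (Fin (k n) → ZMod q) → (Fin n → S) → (Fin n → ZMod q),
      1 - ε ≤ blockProb J {zs : Fin n → ZMod q × S |
        ψ ((H n).mulVec (fun i => (zs i).1)) (fun i => (zs i).2) = fun i => (zs i).1}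

end Good

/-! ### Nested linear codes -/

/-- A nested linear code of block length `n` over `ℤ/q`: the parity-check matrix of the coarse
code consists of the rows of the matrix `H₁` of the fine code and of `m` further rows `ΔH`. -/
structure NestedLinearCode (q n : ℕ) where
  /-- number of parity checks of the fine code -/
  k₁ : ℕ
  /-- number of additional parity checks of the coarse code -/
  m : ℕ
  /-- parity-check matrix of the fine code -/
  H₁ : Matrix (Fin k₁) (Fin n) (ZMod q)
  /-- additional rows -/
  ΔH : Matrix (Fin m) (Fin n) (ZMod q)

namespace NestedLinearCode

variable {q n : ℕ} (C : NestedLinearCode q n)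

/-- Number of parity checks of the coarse code. -/
def k₂ : ℕ := C.k₁ + C.m

/-- Parity-check matrix of the coarse code: `H₁` stacked on top of `ΔH`. -/
def H₂ : Matrix (Fin C.k₂) (Fin n) (ZMod q) := Matrix.of (Fin.append C.H₁ C.ΔH)

/-- The fine code `C₁`. -/
def fine : Submodule (ZMod q) (Fin n → ZMod q) := code C.H₁

/-- The coarse code `C₂`. -/
def coarse : Submodule (ZMod q) (Fin n → ZMod q) := code C.H₂

/-- The rate `(k₂ - k₁) / n * log q`, i.e. `1 / n` times the logarithm of the number `q ^ m` of
messages. -/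
def rate : ℝ := ((C.k₂ : ℝ) - C.k₁) / n * Real.log q

theorem H₂_castAdd (j : Fin C.k₁) : C.H₂ (Fin.castAdd C.m j) = C.H₁ j :=
  Fin.append_left C.H₁ C.ΔH j

theorem H₂_natAdd (j : Fin C.m) : C.H₂ (Fin.natAdd C.k₁ j) = C.ΔH j :=
  Fin.append_right C.H₁ C.ΔH j

theorem mem_coarse (u : Fin n → ZMod q) :
    u ∈ C.coarse ↔ u ∈ C.fine ∧ C.ΔH.mulVec u = 0 := by
  have hA : ∀ j, C.H₂.mulVec u (Fin.castAdd C.m j) = C.H₁.mulVec u j :=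
    fun j => congrArg (fun v => v ⬝ᵥ u) (C.H₂_castAdd j)
  have hB : ∀ j, C.H₂.mulVec u (Fin.natAdd C.k₁ j) = C.ΔH.mulVec u j :=
    fun j => congrArg (fun v => v ⬝ᵥ u) (C.H₂_natAdd j)
  simp only [coarse, fine, code, LinearMap.mem_ker, Matrix.mulVecLin_apply]
  constructor
  · intro h
    exact ⟨funext fun j => (hA j).symm.trans (congrFun h _),
      funext fun j => (hB j).symm.trans (congrFun h _)⟩
  · rintro ⟨h1, h2⟩
    funext i
    refine Fin.addCases (m := C.k₁) (n := C.m) (fun j => ?_) (fun j => ?_) i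
    · exact (hA j).trans (congrFun h1 j)
    · exact (hB j).trans (congrFun h2 j)

/-- The codes are nested. -/
theorem coarse_le_fine : C.coarse ≤ C.fine := fun u hu => ((C.mem_coarse u).1 hu).1

/-- A coding scheme for the source alphabet `X` that uses the nested linear code. The encoder
quantizes the source sequence to a word of the fine code and transmits the coset of the coarse
code to which this word belongs, in the form of its syndrome with respect to `ΔH`. The decoder
replaces a coset by its leader, which is a word of the fine code in that coset. -/
structure Scheme (X : Type*) where
  /-- the quantizer -/
  quantize : (Fin n → X) → (Fin n → ZMod q)
  quantize_mem : ∀ x, quantize x ∈ C.fine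
  /-- the coset leaders, indexed by the messages -/
  leader : (Fin C.m → ZMod q) → (Fin n → ZMod q)
  leader_mem : ∀ s, leader s ∈ C.fine
  leader_coset : ∀ u ∈ C.fine, leader (C.ΔH.mulVec u) - u ∈ C.coarse

namespace Scheme

variable {C} {X Y : Type*} (T : C.Scheme X)

/-- The message sent by the encoder, one of `q ^ m`. -/
def message (x : Fin n → X) : Fin C.m → ZMod q := C.ΔH.mulVec (T.quantize x)

/-- The word of the fine code at the output of the decoder. -/
def decoded (x : Fin n → X) : Fin n → ZMod q := T.leader (T.message x)

/-- Expected distortion per letter of the scheme, when the source is memoryless with distribution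
`P` and the decoded word is read in the reconstruction alphabet through the symbol map `g`. -/
def expectedDistortion [Fintype X] (P : X → ℝ) (d : X → Y → ℝ) (g : ZMod q → Y) : ℝ :=
  ∑ x : Fin n → X, (∏ i, P (x i)) * ((∑ i, d (x i) (g (T.decoded x i))) / n)

end Scheme

end NestedLinearCode

end

end NestedCodes

open NestedCodes

/-! The codes come from random linear coding. Draw the rows of `H₁` and `ΔH` uniformly and
independently. A fixed nonzero vector lies in the kernel of a `k`-row matrix with probability `q ^
(-k)`, and for two linearly independent vectors these events are independent.

Covering: a source word is usually jointly typical with about `exp (n H(X̂|X))` words. The number of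
these in `ker H₁` has variance at most `q` times its mean, because only the at most `q` scalar
multiples of a word are correlated with it. Chebyshev's inequality then makes a miss unlikely as
long as `q ^ k₁` is slightly below that count (`sum_not_exists_mulVec_eq_zero_le`).

Separation: there are about `exp (n H(X̂))` typical words. The quantized word depends on `H₁` only,
so another typical word lies in `ker H₁` and agrees with it under `ΔH` with probability at most `q ^
(-k₂)`. The union bound needs `q ^ k₂` slightly above the number of typical words
(`sum_sum_collision_le`). The same count bounds syndrome collisions of an i.i.d. word, which is the
channel-code property.

Averaging the sum of the three error probabilities gives one nested pair that is good for all
purposes (`exists_nested_matrices`, `exists_scheme`). With tolerance `n ^ (-1/4)` the errors vanish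
while the rates lose only `o(1)` (`exists_scheme_sequence`), and `k₂ - k₁` has limiting rate `H(X̂)
- H(X̂|X) = I(X;X̂)`.

The zero word lies in every linear code, so it must not be typical; hence the embedding sends some
letter of positive probability to a nonzero element. The minimum exists because a continuous
function is minimized on a compact set of test channels. -/

/-! ### Product distributions and Chebyshev's inequality. -/

section BlockProb

variable {α : Type*} {p : α → ℝ} {n : ℕ}

theorem prod_law_nonneg (hp : ∀ a, 0 ≤ p a) (x : Fin n → α) : 0 ≤ ∏ i, p (x i) :=
  Finset.prod_nonneg fun i _ => hp (x i)

variable [Fintype α]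

theorem sum_prod_law (hp : p ∈ stdSimplex ℝ α) (n : ℕ) :
    ∑ x : Fin n → α, ∏ i, p (x i) = 1 := by
  classical
  have h := Finset.prod_univ_sum (fun _ : Fin n => (Finset.univ : Finset α)) (fun _ a => p a)
  rw [Fintype.piFinset_univ] at h
  rw [← h, hp.2]
  simp

theorem blockProb_mono (hp : ∀ a, 0 ≤ p a) {A B : Set (Fin n → α)} (h : A ⊆ B) :
    blockProb p A ≤ blockProb p B :=
  Finset.sum_le_sum fun x _ =>
    Set.indicator_le_indicator_of_subset h (fun _ => prod_law_nonneg hp _) x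

theorem blockProb_nonneg (hp : ∀ a, 0 ≤ p a) (A : Set (Fin n → α)) : 0 ≤ blockProb p A :=
  Finset.sum_nonneg fun _ _ => Set.indicator_nonneg (fun _ _ => prod_law_nonneg hp _) _

theorem blockProb_union_le (hp : ∀ a, 0 ≤ p a) (A B : Set (Fin n → α)) :
    blockProb p (A ∪ B) ≤ blockProb p A + blockProb p B := by
  unfold blockProb
  rw [← Finset.sum_add_distrib]
  refine Finset.sum_le_sum fun x _ => ?_
  have h0 := prod_law_nonneg hp x
  by_cases ha : x ∈ A <;> by_cases hb : x ∈ B <;> simp [ha, hb, h0]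

theorem blockProb_compl (hp : p ∈ stdSimplex ℝ α) (A : Set (Fin n → α)) :
    blockProb p Aᶜ = 1 - blockProb p A := by
  rw [← sum_prod_law hp n, eq_sub_iff_add_eq]
  unfold blockProb
  rw [← Finset.sum_add_distrib]
  refine Finset.sum_congr rfl fun x _ => ?_
  by_cases ha : x ∈ A <;> simp [ha]

theorem blockProb_iUnion_le {ι : Type*} [Fintype ι] (hp : ∀ a, 0 ≤ p a)
    (A : ι → Set (Fin n → α)) :
    blockProb p (⋃ j, A j) ≤ ∑ j, blockProb p (A j) := by
  unfold blockProb
  rw [Finset.sum_comm]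
  refine Finset.sum_le_sum fun x _ => ?_
  have h0 : ∀ j, 0 ≤ (A j).indicator (fun x => ∏ i, p (x i)) x := fun j =>
    Set.indicator_nonneg (fun _ _ => prod_law_nonneg hp _) _
  by_cases hx : x ∈ ⋃ j, A j
  · obtain ⟨j, hj⟩ := Set.mem_iUnion.1 hx
    rw [Set.indicator_of_mem hx]
    calc _ = (A j).indicator (fun x => ∏ i, p (x i)) x := by rw [Set.indicator_of_mem hj]
      _ ≤ _ := Finset.single_le_sum (fun j _ => h0 j) (Finset.mem_univ j)
  · rw [Set.indicator_of_notMem hx]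
    exact Finset.sum_nonneg fun j _ => h0 j

/-- Splitting off the first letter gives the recursion for the moments below. -/
theorem sum_law_cons (F : (Fin (n + 1) → α) → ℝ) :
    ∑ x : Fin (n + 1) → α, (∏ i, p (x i)) * F x =
      ∑ a, p a * ∑ x : Fin n → α, (∏ i, p (x i)) * F (Fin.cons a x) := by
  rw [← (Fin.consEquiv (fun _ => α)).sum_comp, Fintype.sum_prod_type]
  refine Finset.sum_congr rfl fun a _ => ?_
  rw [Finset.mul_sum]
  refine Finset.sum_congr rfl fun x _ => ?_
  simp [Fin.consEquiv, Fin.prod_univ_succ, mul_assoc]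

theorem sum_law_sum (hp : p ∈ stdSimplex ℝ α) {f : α → ℝ} (hf : ∑ a, p a * f a = 0) (n : ℕ) :
    ∑ x : Fin n → α, (∏ i, p (x i)) * ∑ i, f (x i) = 0 := by
  induction n with
  | zero => simp
  | succ n ih =>
    rw [sum_law_cons (p := p)]
    simp only [Fin.sum_univ_succ, Fin.cons_zero, Fin.cons_succ, mul_add, Finset.sum_add_distrib,
      ih, ← Finset.sum_mul, sum_prod_law hp n]
    simpa using hf

/-- The cross terms vanish because the letters are independent and `f` is centred, so the variances
add. -/
theorem sum_law_sum_sq (hp : p ∈ stdSimplex ℝ α) {f : α → ℝ} (hf : ∑ a, p a * f a = 0) (n : ℕ) :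
    ∑ x : Fin n → α, (∏ i, p (x i)) * (∑ i, f (x i)) ^ 2 = n * ∑ a, p a * f a ^ 2 := by
  induction n with
  | zero => simp
  | succ n ih =>
    rw [sum_law_cons (p := p)]
    have key : ∀ a, ∑ x : Fin n → α, (∏ i, p (x i)) *
        (∑ i, f ((Fin.cons a x : Fin (n + 1) → α) i)) ^ 2 =
        f a ^ 2 + n * ∑ a, p a * f a ^ 2 := by
      intro a
      have h : ∀ x : Fin n → α, (∏ i, p (x i)) *
          (∑ i, f ((Fin.cons a x : Fin (n + 1) → α) i)) ^ 2 =
          f a ^ 2 * (∏ i, p (x i)) + 2 * f a * ((∏ i, p (x i)) * ∑ i, f (x i)) +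
            (∏ i, p (x i)) * (∑ i, f (x i)) ^ 2 := by
        intro x
        simp only [Fin.sum_univ_succ, Fin.cons_zero, Fin.cons_succ]
        ring
      simp only [h, Finset.sum_add_distrib, ← Finset.mul_sum, sum_prod_law hp n,
        sum_law_sum hp hf n, ih]
      ring
    simp only [key, mul_add, Finset.sum_add_distrib, ← Finset.sum_mul, hp.2]
    push_cast
    ring

/-- Chebyshev's inequality for the sum of a centred function of the letters. -/
theorem blockProb_abs_sum_gt_le (hp : p ∈ stdSimplex ℝ α) {f : α → ℝ}
    (hf : ∑ a, p a * f a = 0) {t : ℝ} (ht : 0 < t) :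
    blockProb p {x : Fin n → α | t < |∑ i, f (x i)|} ≤ n * (∑ a, p a * f a ^ 2) / t ^ 2 := by
  rw [le_div_iff₀ (by positivity), ← sum_law_sum_sq hp hf n, blockProb, Finset.sum_mul]
  refine Finset.sum_le_sum fun x _ => ?_
  have h0 := prod_law_nonneg hp.1 x
  by_cases hx : x ∈ {x : Fin n → α | t < |∑ i, f (x i)|}
  · rw [Set.indicator_of_mem hx]
    refine mul_le_mul_of_nonneg_left ?_ h0
    rw [← sq_abs (∑ i, f (x i))]
    exact pow_le_pow_left₀ ht.le (le_of_lt hx) 2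
  · rw [Set.indicator_of_notMem hx, zero_mul]
    positivity

end BlockProb

/-! ### Strongly typical sequences: probability and number. -/

section Typical

variable {α : Type*} {p : α → ℝ} {n : ℕ}

theorem NestedCodes.IsTypical.mono {ε δ : ℝ} (h : ε ≤ δ) {x : Fin n → α} (hx : IsTypical p ε x) :
    IsTypical p δ x :=
  fun a => ⟨(hx a).1.trans h, (hx a).2⟩

theorem ncard_eq_sum_ite [DecidableEq α] (x : Fin n → α) (a : α) :
    (({i | x i = a} : Set (Fin n)).ncard : ℝ) = ∑ i, if x i = a then 1 else 0 := by
  rw [Set.ncard_eq_toFinset_card', Finset.sum_boole]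
  congr 2
  ext i
  simp

/-- No positivity of `n` is needed: for `n = 0` both sides are zero. -/
theorem ncard_div_mul (x : Fin n → α) (a : α) :
    (({i | x i = a} : Set (Fin n)).ncard : ℝ) =
      n * ((({i | x i = a} : Set (Fin n)).ncard : ℝ) / n) := by
  rcases Nat.eq_zero_or_pos n with rfl | hn
  · have : ({i | x i = a} : Set (Fin 0)) = ∅ := Set.eq_empty_of_isEmpty _
    simp [this]
  · field_simp

theorem NestedCodes.IsTypical.pos {δ : ℝ} (hp : ∀ a, 0 ≤ p a) {x : Fin n → α} (hx : IsTypical p δ x)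
    (i : Fin n) : 0 < p (x i) :=
  lt_of_le_of_ne (hp _) fun h => (hx (x i)).2 h.symm i rfl

variable [Fintype α]

theorem sum_eq_sum_ncard (x : Fin n → α) (f : α → ℝ) :
    ∑ i, f (x i) = ∑ a, (({i | x i = a} : Set (Fin n)).ncard : ℝ) * f a := by
  classical
  simp only [ncard_eq_sum_ite, Finset.sum_mul]
  rw [Finset.sum_comm]
  simp

/-- The typical average of a function of the letters. -/
theorem NestedCodes.IsTypical.abs_sum_sub_le {δ : ℝ} {x : Fin n → α} (hx : IsTypical p δ x) (f : α → ℝ) :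
    |∑ i, f (x i) - n * ∑ a, p a * f a| ≤ n * (δ * ∑ a, |f a|) := by
  have h : ∑ i, f (x i) - n * ∑ a, p a * f a =
      n * ∑ a, ((({i | x i = a} : Set (Fin n)).ncard : ℝ) / n - p a) * f a := by
    rw [sum_eq_sum_ncard]
    simp only [sub_mul, Finset.sum_sub_distrib, mul_sub, Finset.mul_sum]
    congr 1
    refine Finset.sum_congr rfl fun a _ => ?_
    rw [← mul_assoc, ← ncard_div_mul]
  rw [h, abs_mul, Nat.abs_cast, Finset.mul_sum]
  refine mul_le_mul_of_nonneg_left ?_ (Nat.cast_nonneg n)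
  refine (Finset.abs_sum_le_sum_abs _ _).trans (Finset.sum_le_sum fun a _ => ?_)
  rw [abs_mul]
  exact mul_le_mul_of_nonneg_right (hx a).1 (abs_nonneg _)

theorem blockProb_letter_zero (x₀ : α) (h : p x₀ = 0) :
    blockProb p {x : Fin n → α | ∃ i, x i = x₀} = 0 := by
  refine Finset.sum_eq_zero fun x _ => ?_
  refine Set.indicator_apply_eq_zero.2 ?_
  rintro ⟨i, hi⟩
  exact Finset.prod_eq_zero (Finset.mem_univ i) (by rw [hi, h])

/-- A memoryless sequence is strongly typical with high probability. -/
theorem blockProb_typical_ge (hp : p ∈ stdSimplex ℝ α) {δ : ℝ} (hδ : 0 < δ) (hn : 0 < n) :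
    1 - Fintype.card α / (n * δ ^ 2) ≤ blockProb p {x : Fin n → α | IsTypical p δ x} := by
  classical
  have hn' : (0 : ℝ) < n := Nat.cast_pos.2 hn
  -- An atypical word fails at some letter `a`: either its frequency deviates, which Chebyshev
  -- controls, or `a` has probability zero and occurs, a null event.
  let B : α → Set (Fin n → α) := fun a =>
    {x | (n * δ) < |∑ i, ((if x i = a then 1 else 0) - p a)|} ∪
      {x | p a = 0 ∧ ∃ i, x i = a}
  have hsub : {x : Fin n → α | IsTypical p δ x}ᶜ ⊆ ⋃ a, B a := by
    intro x hx
    by_contra hB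
    refine hx fun a => ?_
    have ha : x ∉ B a := fun h => hB (Set.mem_iUnion.2 ⟨a, h⟩)
    simp only [B, Set.mem_union, Set.mem_ofPred_eq, not_or, not_lt, not_and, not_exists] at ha
    refine ⟨?_, ha.2⟩
    have h1 := ha.1
    rw [Finset.sum_sub_distrib, ← ncard_eq_sum_ite] at h1
    simp only [Finset.sum_const, Finset.card_univ, Fintype.card_fin, nsmul_eq_mul] at h1
    rw [ncard_div_mul, ← mul_sub, abs_mul, Nat.abs_cast] at h1
    exact le_of_mul_le_mul_left h1 hn'
  have hB : ∀ a, blockProb p (B a) ≤ 1 / (n * δ ^ 2) := by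
    intro a
    refine (blockProb_union_le hp.1 _ _).trans ?_
    have h2 : blockProb p {x : Fin n → α | p a = 0 ∧ ∃ i, x i = a} = 0 := by
      by_cases ha : p a = 0
      · simpa [ha] using blockProb_letter_zero (n := n) a ha
      · simp [ha, blockProb]
    have hpa : p a ≤ 1 := by
      rw [← hp.2]; exact Finset.single_le_sum (fun b _ => hp.1 b) (Finset.mem_univ a)
    have hz : ∑ b, p b * ((if b = a then 1 else 0) - p a) = 0 := by
      simp [mul_sub, ← Finset.sum_mul, hp.2]
    have hv : ∑ b, p b * ((if b = a then 1 else 0) - p a) ^ 2 ≤ 1 := by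
      refine le_trans (Finset.sum_le_sum fun b _ => ?_) hp.2.le
      refine mul_le_of_le_one_right (hp.1 b) ?_
      have := hp.1 a
      split_ifs <;> nlinarith
    have h1 := blockProb_abs_sum_gt_le (n := n) hp hz (mul_pos hn' hδ)
    rw [h2, add_zero]
    refine h1.trans ?_
    rw [div_le_div_iff₀ (by positivity) (by positivity)]
    calc _ ≤ n * 1 * (n * δ ^ 2) := by gcongr
      _ = _ := by ring
  have h1 := (blockProb_mono hp.1 hsub).trans (blockProb_iUnion_le hp.1 B)
  have h2 : ∑ a, blockProb p (B a) ≤ Fintype.card α / (n * δ ^ 2) := by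
    refine (Finset.sum_le_sum fun a _ => hB a).trans (le_of_eq ?_)
    simp [div_eq_mul_inv]
  rw [blockProb_compl hp] at h1
  linarith

/-- The typical sequences number at most `exp (n (H + δ L))`. -/
theorem ncard_typical_le (hp : p ∈ stdSimplex ℝ α) (δ : ℝ) :
    (({x | IsTypical p δ x} : Set (Fin n → α)).ncard : ℝ) ≤
      Real.exp (n * (entropy p + δ * ∑ a, |Real.log (p a)|)) := by
  classical
  -- Each typical word has at least this probability, and the probabilities sum to at most one. The
  -- convention `log 0 = 0` is harmless, since typical words avoid letters of probability zero.
  have hlow : ∀ x : Fin n → α, IsTypical p δ x →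
      Real.exp (-(n * (entropy p + δ * ∑ a, |Real.log (p a)|))) ≤ ∏ i, p (x i) := by
    intro x hx
    have h1 : ∏ i, p (x i) = Real.exp (∑ i, Real.log (p (x i))) := by
      rw [Real.exp_sum]
      exact Finset.prod_congr rfl fun i _ => (Real.exp_log (hx.pos hp.1 i)).symm
    have h2 := (abs_le.1 (hx.abs_sum_sub_le fun a => Real.log (p a))).1
    have h3 : entropy p = - ∑ a, p a * Real.log (p a) := by
      simp [entropy, Real.negMulLog]
    rw [h1, Real.exp_le_exp, h3]
    linarith
  refine le_of_mul_le_mul_right ?_ (Real.exp_pos (-(n * (entropy p + δ * ∑ a, |Real.log (p a)|))))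
  rw [← Real.exp_add, add_neg_cancel, Real.exp_zero, Set.ncard_eq_toFinset_card',
    ← nsmul_eq_mul, ← Finset.sum_const, ← sum_prod_law hp n]
  refine (Finset.sum_le_sum fun x hx => hlow x (by simpa using hx)).trans ?_
  exact Finset.sum_le_sum_of_subset_of_nonneg (Finset.subset_univ _)
    fun x _ _ => prod_law_nonneg hp.1 x

end Typical

/-! ### Uniformly random parity-check matrices. -/

section RandomMatrix

open Classical in
/-- A surjective linear map from a finite space vanishes on a fraction `1 / |W|` of the space. -/
theorem sum_ker_indicator_eq {F V W : Type*} [Field F] [AddCommGroup V] [Module F V] [Fintype V]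
    [AddCommGroup W] [Module F W] [Fintype W] (φ : V →ₗ[F] W) (hφ : Function.Surjective φ) :
    (∑ v, if φ v = 0 then (1 : ℝ) else 0) = Fintype.card V / Fintype.card W := by
  have h1 := φ.ker.toAddSubgroup.card_eq_card_quotient_mul_card_addSubgroup
  have h2 : Nat.card (V ⧸ φ.ker) = Nat.card W :=
    Nat.card_congr (φ.quotKerEquivOfSurjective hφ).toEquiv
  have h3 : Nat.card V = Nat.card W * Nat.card φ.ker := by rw [← h2]; exact h1
  have h4 : (∑ v, if φ v = 0 then (1 : ℝ) else 0) = Nat.card φ.ker := by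
    rw [Finset.sum_boole, Nat.card_eq_fintype_card, Fintype.card_subtype]
    simp [LinearMap.mem_ker]
  have hW : (Fintype.card W : ℝ) ≠ 0 := Nat.cast_ne_zero.2 Fintype.card_ne_zero
  rw [h4, eq_div_iff hW, mul_comm, ← Nat.card_eq_fintype_card, ← Nat.card_eq_fintype_card, h3]
  push_cast
  ring

/-- A linear map prescribed on the span of an independent family extends to the whole space. This is
the surjectivity that turns kernel counts into exact fractions `1 / q ^ k` and `1 / q ^ (2 k)`. -/
theorem exists_mulVec_eq {F : Type*} [Field F] {ι : Type*} {n k : ℕ} {v : ι → Fin n → F}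
    (hv : LinearIndependent F v) (w : ι → Fin k → F) :
    ∃ H : Matrix (Fin k) (Fin n) F, ∀ j, H.mulVec (v j) = w j := by
  let b := Module.Basis.span hv
  obtain ⟨g, hg⟩ := LinearMap.exists_extend (b.constr F w)
  refine ⟨LinearMap.toMatrix' g, fun j => ?_⟩
  rw [LinearMap.toMatrix'_mulVec]
  have h1 : (b j : Fin n → F) = v j := by simp [b, Module.Basis.span_apply]
  have h2 := LinearMap.congr_fun hg (b j)
  rw [Module.Basis.constr_basis] at h2
  rw [← h1]
  exact h2

variable {q : ℕ} [Fact q.Prime] {n k : ℕ}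

/-- The fraction of matrices whose kernel contains a given nonzero vector. -/
theorem sum_mulVec_eq_zero {v : Fin n → ZMod q} (hv : v ≠ 0) :
    (∑ H : Matrix (Fin k) (Fin n) (ZMod q), if H.mulVec v = 0 then (1 : ℝ) else 0) =
      Fintype.card (Matrix (Fin k) (Fin n) (ZMod q)) / (q : ℝ) ^ k := by
  classical
  let φ : Matrix (Fin k) (Fin n) (ZMod q) →ₗ[ZMod q] (Fin k → ZMod q) :=
    { toFun := fun H => H.mulVec v
      map_add' := fun A B => Matrix.add_mulVec A B v
      map_smul' := fun c A => Matrix.smul_mulVec c A v }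
  have hφ : Function.Surjective φ := by
    intro w
    obtain ⟨H, hH⟩ := exists_mulVec_eq (LinearIndependent.of_subsingleton (v := fun _ : Unit => v)
      () hv) (fun _ => w)
    exact ⟨H, hH ()⟩
  have h := sum_ker_indicator_eq φ hφ
  rw [show Fintype.card (Fin k → ZMod q) = q ^ k by simp [ZMod.card]] at h
  push_cast at h
  rw [← h]
  exact Finset.sum_congr rfl fun H _ => by congr

/-- The fraction of matrices whose kernel contains two given independent vectors. -/
theorem sum_mulVec_pair_eq_zero {u v : Fin n → ZMod q} (huv : LinearIndependent (ZMod q) ![u, v]) :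
    (∑ H : Matrix (Fin k) (Fin n) (ZMod q),
      (if H.mulVec u = 0 then (1 : ℝ) else 0) * (if H.mulVec v = 0 then (1 : ℝ) else 0)) =
      Fintype.card (Matrix (Fin k) (Fin n) (ZMod q)) / ((q : ℝ) ^ k * (q : ℝ) ^ k) := by
  classical
  let φ : Matrix (Fin k) (Fin n) (ZMod q) →ₗ[ZMod q] (Fin k → ZMod q) × (Fin k → ZMod q) :=
    { toFun := fun H => (H.mulVec u, H.mulVec v)
      map_add' := fun A B => by simp [Matrix.add_mulVec]
      map_smul' := fun c A => by simp [Matrix.smul_mulVec] }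
  have hφ : Function.Surjective φ := by
    rintro ⟨w, z⟩
    obtain ⟨H, hH⟩ := exists_mulVec_eq huv ![w, z]
    exact ⟨H, Prod.ext (hH 0) (hH 1)⟩
  have h := sum_ker_indicator_eq φ hφ
  rw [show Fintype.card ((Fin k → ZMod q) × (Fin k → ZMod q)) = q ^ k * q ^ k by
    simp [ZMod.card]] at h
  push_cast at h
  rw [← h]
  refine Finset.sum_congr rfl fun H _ => ?_
  have hiff : φ H = 0 ↔ H.mulVec u = 0 ∧ H.mulVec v = 0 := Prod.mk_eq_zero
  by_cases h1 : H.mulVec u = 0 <;> by_cases h2 : H.mulVec v = 0 <;> simp [hiff, h1, h2]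

open Classical in
/-- Second moment of the number of elements of `A` in the kernel of a random matrix. -/
theorem sum_sq_count_le (A : Finset (Fin n → ZMod q)) (hA : ∀ u ∈ A, u ≠ 0) :
    (∑ H : Matrix (Fin k) (Fin n) (ZMod q),
      (∑ u ∈ A, if H.mulVec u = 0 then (1 : ℝ) else 0) ^ 2) ≤
      Fintype.card (Matrix (Fin k) (Fin n) (ZMod q)) *
        (A.card * q / (q : ℝ) ^ k + (A.card / (q : ℝ) ^ k) ^ 2) := by
  set N : ℝ := (Fintype.card (Matrix (Fin k) (Fin n) (ZMod q)) : ℝ)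
  have hq : (0 : ℝ) < q := Nat.cast_pos.2 (Fact.out : q.Prime).pos
  have hN : 0 ≤ N := Nat.cast_nonneg _
  -- Independent pairs contribute the product probability; for proportional pairs, the joint event
  -- is bounded by the event for `u` alone.
  have hpair : ∀ u ∈ A, ∀ v ∈ A, (∑ H : Matrix (Fin k) (Fin n) (ZMod q),
      (if H.mulVec u = 0 then (1 : ℝ) else 0) * (if H.mulVec v = 0 then (1 : ℝ) else 0)) ≤
      (if ∃ c : ZMod q, v = c • u then N / (q : ℝ) ^ k else 0) + N / ((q : ℝ) ^ k * (q : ℝ) ^ k) := by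
    intro u hu v hv
    by_cases h : ∃ c : ZMod q, v = c • u
    · rw [if_pos h, ← sum_mulVec_eq_zero (hA u hu)]
      have : 0 ≤ N / ((q : ℝ) ^ k * (q : ℝ) ^ k) := by positivity
      refine le_add_of_le_of_nonneg (Finset.sum_le_sum fun H _ => ?_) this
      split_ifs <;> norm_num
    · rw [if_neg h, zero_add]
      refine le_of_eq (sum_mulVec_pair_eq_zero ?_)
      refine (LinearIndependent.pair_iff' (hA u hu)).2 fun c hc => h ⟨c, hc.symm⟩
  have hline : ∀ u, (∑ v ∈ A, if ∃ c : ZMod q, v = c • u then N / (q : ℝ) ^ k else 0) ≤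
      q * (N / (q : ℝ) ^ k) := by
    intro u
    rw [← Finset.sum_filter, Finset.sum_const, nsmul_eq_mul]
    refine mul_le_mul_of_nonneg_right ?_ (by positivity)
    have : A.filter (fun v => ∃ c : ZMod q, v = c • u) ⊆
        Finset.univ.image fun c : ZMod q => c • u := by
      intro v hv
      obtain ⟨c, hc⟩ := (Finset.mem_filter.1 hv).2
      exact Finset.mem_image.2 ⟨c, Finset.mem_univ _, hc.symm⟩
    have h2 := (Finset.card_le_card this).trans Finset.card_image_le
    rw [Finset.card_univ, ZMod.card] at h2
    exact_mod_cast h2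
  calc _ = ∑ u ∈ A, ∑ v ∈ A, ∑ H : Matrix (Fin k) (Fin n) (ZMod q),
      (if H.mulVec u = 0 then (1 : ℝ) else 0) * (if H.mulVec v = 0 then (1 : ℝ) else 0) := by
        simp only [sq, Finset.sum_mul_sum]
        rw [Finset.sum_comm]
        refine Finset.sum_congr rfl fun u _ => ?_
        rw [Finset.sum_comm]
    _ ≤ ∑ u ∈ A, ∑ v ∈ A, ((if ∃ c : ZMod q, v = c • u then N / (q : ℝ) ^ k else 0) +
        N / ((q : ℝ) ^ k * (q : ℝ) ^ k)) :=
        Finset.sum_le_sum fun u hu => Finset.sum_le_sum fun v hv => hpair u hu v hv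
    _ ≤ ∑ u ∈ A, (q * (N / (q : ℝ) ^ k) + A.card * (N / ((q : ℝ) ^ k * (q : ℝ) ^ k))) := by
        refine Finset.sum_le_sum fun u _ => ?_
        rw [Finset.sum_add_distrib, Finset.sum_const, nsmul_eq_mul]
        exact add_le_add_left (hline u) _
    _ = _ := by
        rw [Finset.sum_const, nsmul_eq_mul]
        field_simp

open Classical in
/-- The kernel of a random matrix meets a large set with high probability. -/
theorem sum_not_exists_mulVec_eq_zero_le (A : Finset (Fin n → ZMod q)) (hA : ∀ u ∈ A, u ≠ 0) :
    (∑ H : Matrix (Fin k) (Fin n) (ZMod q),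
      if ∃ u ∈ A, H.mulVec u = 0 then (0 : ℝ) else 1) * A.card ≤
      Fintype.card (Matrix (Fin k) (Fin n) (ZMod q)) * (q * (q : ℝ) ^ k) := by
  set N : ℝ := (Fintype.card (Matrix (Fin k) (Fin n) (ZMod q)) : ℝ) with hNdef
  have hq : (0 : ℝ) < q := Nat.cast_pos.2 (Fact.out : q.Prime).pos
  have hN : 0 ≤ N := Nat.cast_nonneg _
  rcases A.eq_empty_or_nonempty with rfl | hne
  · simp only [Finset.card_empty, Nat.cast_zero, mul_zero]; positivity
  have hc : (0 : ℝ) < A.card := Nat.cast_pos.2 hne.card_pos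
  set μ : ℝ := A.card / (q : ℝ) ^ k with hμ
  have hμ0 : 0 < μ := by positivity
  let Z : Matrix (Fin k) (Fin n) (ZMod q) → ℝ := fun H =>
    ∑ u ∈ A, if H.mulVec u = 0 then (1 : ℝ) else 0
  have hmean : ∑ H, Z H = N * μ := by
    simp only [Z]
    rw [Finset.sum_comm, Finset.sum_congr rfl fun u hu => sum_mulVec_eq_zero (k := k) (hA u hu),
      Finset.sum_const, nsmul_eq_mul]
    ring
  -- The `μ ^ 2` part of the second moment cancels, leaving only the contribution of the
  -- proportional pairs.
  have hvar : ∑ H, (Z H - μ) ^ 2 ≤ N * (μ * q) := by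
    have h : ∀ H, (Z H - μ) ^ 2 = Z H ^ 2 - 2 * μ * Z H + μ ^ 2 := fun H => by ring
    have h2 := sum_sq_count_le (k := k) A hA
    simp only [h, Finset.sum_add_distrib, Finset.sum_sub_distrib, ← Finset.mul_sum, hmean,
      Finset.sum_const, Finset.card_univ, nsmul_eq_mul]
    calc _ ≤ N * (A.card * q / (q : ℝ) ^ k + μ ^ 2) - 2 * μ * (N * μ) + N * μ ^ 2 := by
          gcongr
      _ = _ := by rw [hμ]; ring
  -- Chebyshev: a matrix whose kernel misses `A` has `Z H = 0`, so its squared deviation is exactly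
  -- `μ ^ 2`.
  have hbad : (∑ H : Matrix (Fin k) (Fin n) (ZMod q),
      if ∃ u ∈ A, H.mulVec u = 0 then (0 : ℝ) else 1) * μ ^ 2 ≤ N * (μ * q) := by
    refine le_trans ?_ hvar
    rw [Finset.sum_mul]
    refine Finset.sum_le_sum fun H _ => ?_
    split_ifs with h
    · rw [zero_mul]; positivity
    · have : Z H = 0 := Finset.sum_eq_zero fun u hu => if_neg fun h0 => h ⟨u, hu, h0⟩
      rw [this]
      apply le_of_eq
      ring
  have h3 : (∑ H : Matrix (Fin k) (Fin n) (ZMod q),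
      if ∃ u ∈ A, H.mulVec u = 0 then (0 : ℝ) else 1) * μ ≤ N * q := by
    refine le_of_mul_le_mul_right ?_ hμ0
    calc _ = _ := by ring
      _ ≤ _ := hbad
      _ = _ := by ring
  rw [hμ, ← mul_div_assoc, div_le_iff₀ (by positivity)] at h3
  linarith

end RandomMatrix

/-! ### Random nested pairs of matrices. -/

section RandomNested

variable {q : ℕ} [Fact q.Prime] {n k m : ℕ}

open Classical in
/-- Collision probability of `u` and `Q H₁` under the random rows `ΔH`, on the event that the random
matrix `H₁` annihilates `v`. -/
theorem sum_sum_collision_le {u v : Fin n → ZMod q} (hv : v ≠ 0)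
    (Q : Matrix (Fin k) (Fin n) (ZMod q) → Fin n → ZMod q) :
    (∑ H : Matrix (Fin k) (Fin n) (ZMod q), ∑ K : Matrix (Fin m) (Fin n) (ZMod q),
      if u ≠ Q H ∧ H.mulVec v = 0 ∧ K.mulVec u = K.mulVec (Q H) then (1 : ℝ) else 0) ≤
      Fintype.card (Matrix (Fin k) (Fin n) (ZMod q)) *
        Fintype.card (Matrix (Fin m) (Fin n) (ZMod q)) / (q : ℝ) ^ (k + m) := by
  -- For fixed `H` the word `Q H` is fixed too, so when `u ≠ Q H` the rows `K` annihilate the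
  -- nonzero vector `u - Q H` on a fraction `q ^ (-m)` of the matrices.
  have hinner : ∀ H : Matrix (Fin k) (Fin n) (ZMod q),
      (∑ K : Matrix (Fin m) (Fin n) (ZMod q),
        if u ≠ Q H ∧ H.mulVec v = 0 ∧ K.mulVec u = K.mulVec (Q H) then (1 : ℝ) else 0) ≤
      (if H.mulVec v = 0 then 1 else 0) *
        (Fintype.card (Matrix (Fin m) (Fin n) (ZMod q)) / (q : ℝ) ^ m) := by
    intro H
    by_cases hu : u = Q H
    · simp only [ne_eq, hu, not_true_eq_false, false_and, if_false, Finset.sum_const_zero]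
      positivity
    by_cases hH : H.mulVec v = 0
    · rw [if_pos hH, one_mul, ← sum_mulVec_eq_zero (sub_ne_zero.2 hu)]
      refine le_of_eq (Finset.sum_congr rfl fun K _ => ?_)
      simp [hu, hH, Matrix.mulVec_sub, sub_eq_zero]
    · simp [hH]
  refine (Finset.sum_le_sum fun H _ => hinner H).trans (le_of_eq ?_)
  rw [← Finset.sum_mul, sum_mulVec_eq_zero hv, pow_add]
  field_simp

theorem ite_exists_le_sum {V : Type*} (T : Finset V) (p : V → Prop) [DecidablePred p]
    [Decidable (∃ u ∈ T, p u)] :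
    (if ∃ u ∈ T, p u then (1 : ℝ) else 0) ≤ ∑ u ∈ T, if p u then 1 else 0 := by
  have h0 : ∀ u ∈ T, (0 : ℝ) ≤ if p u then 1 else 0 := fun u _ => by split_ifs <;> norm_num
  split_ifs with h
  · obtain ⟨u, hu, hpu⟩ := h
    calc (1 : ℝ) = if p u then 1 else 0 := by rw [if_pos hpu]
      _ ≤ _ := Finset.single_le_sum h0 hu
  · exact Finset.sum_nonneg h0

theorem sum_sum_sum_mul_sum_comm {A B Ω U : Type*} [Fintype A] [Fintype B] [Fintype Ω]
    (T : Finset U) (w : Ω → ℝ) (f : A → B → Ω → U → ℝ) :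
    ∑ a, ∑ b, ∑ ω, w ω * ∑ u ∈ T, f a b ω u = ∑ ω, w ω * ∑ u ∈ T, ∑ a, ∑ b, f a b ω u := by
  have h1 : ∀ a, ∑ b, ∑ ω, w ω * ∑ u ∈ T, f a b ω u = ∑ ω, w ω * ∑ u ∈ T, ∑ b, f a b ω u := by
    intro a
    rw [Finset.sum_comm]
    refine Finset.sum_congr rfl fun ω _ => ?_
    rw [← Finset.mul_sum, Finset.sum_comm]
  rw [Finset.sum_congr rfl fun a _ => h1 a, Finset.sum_comm]
  refine Finset.sum_congr rfl fun ω _ => ?_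
  rw [← Finset.mul_sum, Finset.sum_comm]

-- Union bound over `T`, averaged over both matrices. The vector `v ω u` leaves room for two uses:
-- `u` itself, for competitors inside the fine code, and `u - z`, for equality of syndromes with a
-- word `z` that need not be in the fine code.
open Classical in
theorem sum_sum_weight_exists_le {Ω : Type*} [Fintype Ω] {w : Ω → ℝ} (hw : w ∈ stdSimplex ℝ Ω)
    (T : Finset (Fin n → ZMod q))
    (v : Ω → (Fin n → ZMod q) → Fin n → ZMod q)
    (Q : Matrix (Fin k) (Fin n) (ZMod q) → Ω → Fin n → ZMod q)
    (hv : ∀ ω, ∀ u ∈ T, v ω u = 0 → ∀ H, u = Q H ω) :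
    (∑ H : Matrix (Fin k) (Fin n) (ZMod q), ∑ K : Matrix (Fin m) (Fin n) (ZMod q), ∑ ω,
      w ω * if ∃ u ∈ T, u ≠ Q H ω ∧ H.mulVec (v ω u) = 0 ∧ K.mulVec u = K.mulVec (Q H ω)
        then (1 : ℝ) else 0) ≤
      Fintype.card (Matrix (Fin k) (Fin n) (ZMod q)) *
        Fintype.card (Matrix (Fin m) (Fin n) (ZMod q)) * (T.card / (q : ℝ) ^ (k + m)) := by
  calc
    _ ≤ ∑ H : Matrix (Fin k) (Fin n) (ZMod q), ∑ K : Matrix (Fin m) (Fin n) (ZMod q), ∑ ω,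
      w ω * ∑ u ∈ T, if u ≠ Q H ω ∧ H.mulVec (v ω u) = 0 ∧ K.mulVec u = K.mulVec (Q H ω)
        then (1 : ℝ) else 0 := by
        refine Finset.sum_le_sum fun H _ => Finset.sum_le_sum fun K _ =>
          Finset.sum_le_sum fun ω _ => ?_
        refine mul_le_mul_of_nonneg_left ?_ (hw.1 ω)
        exact ite_exists_le_sum T fun u =>
          u ≠ Q H ω ∧ H.mulVec (v ω u) = 0 ∧ K.mulVec u = K.mulVec (Q H ω)
    _ = ∑ ω, w ω * ∑ u ∈ T, ∑ H : Matrix (Fin k) (Fin n) (ZMod q),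
        ∑ K : Matrix (Fin m) (Fin n) (ZMod q),
        if u ≠ Q H ω ∧ H.mulVec (v ω u) = 0 ∧ K.mulVec u = K.mulVec (Q H ω)
        then (1 : ℝ) else 0 := by
        exact sum_sum_sum_mul_sum_comm T w _
    _ ≤ ∑ ω, w ω * ∑ u ∈ T, (Fintype.card (Matrix (Fin k) (Fin n) (ZMod q)) *
        Fintype.card (Matrix (Fin m) (Fin n) (ZMod q)) / (q : ℝ) ^ (k + m)) := by
        refine Finset.sum_le_sum fun ω _ => mul_le_mul_of_nonneg_left
          (Finset.sum_le_sum fun u hu => ?_) (hw.1 ω)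
        by_cases h : v ω u = 0
        · have := hv ω u hu h
          simp only [ne_eq, ← this, not_true_eq_false, false_and, if_false, Finset.sum_const_zero]
          positivity
        · exact sum_sum_collision_le h fun H => Q H ω
    _ = _ := by
        rw [← Finset.sum_mul, hw.2, Finset.sum_const, nsmul_eq_mul]
        ring

-- On `G` the second-moment estimate applies; off `G` the error is bounded by one. The case `k = 0`
-- is separated because a matrix without rows annihilates everything, so a nonempty `A ω` is always
-- covered, whereas `q / N` need not be small.
open Classical in
theorem sum_weight_not_covered_le {Ω : Type*} [Fintype Ω] {w : Ω → ℝ} (hw : w ∈ stdSimplex ℝ Ω)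
    (A : Ω → Finset (Fin n → ZMod q)) (hA : ∀ ω, ∀ u ∈ A ω, u ≠ 0) (G : Set Ω) {N : ℝ}
    (hN : 0 < N) (hG : ∀ ω ∈ G, N ≤ (A ω).card) :
    (∑ H : Matrix (Fin k) (Fin n) (ZMod q), ∑ ω,
      w ω * if ∃ u ∈ A ω, H.mulVec u = 0 then (0 : ℝ) else 1) ≤
      Fintype.card (Matrix (Fin k) (Fin n) (ZMod q)) *
        (∑ ω, Gᶜ.indicator w ω + if k = 0 then 0 else q * (q : ℝ) ^ k / N) := by
  set c : ℝ := if k = 0 then 0 else q * (q : ℝ) ^ k / N with hc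
  set M : ℝ := (Fintype.card (Matrix (Fin k) (Fin n) (ZMod q)) : ℝ) with hM
  have hc0 : 0 ≤ c := by rw [hc]; split_ifs <;> positivity
  have hM0 : 0 ≤ M := Nat.cast_nonneg _
  have hpt : ∀ ω, w ω * (∑ H : Matrix (Fin k) (Fin n) (ZMod q),
      if ∃ u ∈ A ω, H.mulVec u = 0 then (0 : ℝ) else 1) ≤ M * (Gᶜ.indicator w ω + w ω * c) := by
    intro ω
    have hwω := hw.1 ω
    by_cases hω : ω ∈ G
    · have hcard : (0 : ℝ) < (A ω).card := hN.trans_le (hG ω hω)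
      rw [Set.indicator_of_notMem (by simpa using hω), zero_add, mul_left_comm]
      refine mul_le_mul_of_nonneg_left ?_ hwω
      by_cases hk : k = 0
      · subst hk
        obtain ⟨u, hu⟩ := Finset.card_pos.1 (Nat.cast_pos.1 hcard)
        refine le_trans (le_of_eq (Finset.sum_eq_zero fun H _ => ?_)) (mul_nonneg hM0 hc0)
        exact if_pos ⟨u, hu, Subsingleton.elim _ _⟩
      · rw [hc, if_neg hk]
        have h := sum_not_exists_mulVec_eq_zero_le (k := k) (A ω) (hA ω)
        rw [← le_div_iff₀ hcard] at h
        refine h.trans ?_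
        rw [← mul_div_assoc]
        exact div_le_div_of_nonneg_left (by positivity) hN (hG ω hω)
    · rw [Set.indicator_of_mem (by simpa using hω)]
      have h1 : (∑ H : Matrix (Fin k) (Fin n) (ZMod q),
          if ∃ u ∈ A ω, H.mulVec u = 0 then (0 : ℝ) else 1) ≤ M := by
        calc _ ≤ ∑ _H : Matrix (Fin k) (Fin n) (ZMod q), (1 : ℝ) :=
              Finset.sum_le_sum fun H _ => by split_ifs <;> norm_num
          _ = M := by simp [hM]
      have h2 : 0 ≤ M * (w ω * c) := by positivity
      nlinarith [mul_le_mul_of_nonneg_left h1 hwω]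
  rw [Finset.sum_comm]
  simp only [← Finset.mul_sum]
  refine (Finset.sum_le_sum fun ω _ => hpt ω).trans (le_of_eq ?_)
  rw [← Finset.mul_sum, Finset.sum_add_distrib, ← Finset.sum_mul, hw.2, one_mul]

open Classical in
/-- Random coding: some nested pair of matrices covers, and separates the words chosen by `Q` as
well as random words with weight `r`. -/
theorem exists_nested_matrices {Ω : Type*} [Fintype Ω] {w : Ω → ℝ} (hw : w ∈ stdSimplex ℝ Ω)
    {r : (Fin n → ZMod q) → ℝ} (hr : r ∈ stdSimplex ℝ (Fin n → ZMod q))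
    (T : Finset (Fin n → ZMod q)) (hT : ∀ u ∈ T, u ≠ 0)
    (A : Ω → Finset (Fin n → ZMod q)) (hA : ∀ ω, A ω ⊆ T) (G : Set Ω) {N : ℝ}
    (hN : 0 < N) (hG : ∀ ω ∈ G, N ≤ (A ω).card)
    (Q : Matrix (Fin k) (Fin n) (ZMod q) → Ω → Fin n → ZMod q) :
    ∃ (H : Matrix (Fin k) (Fin n) (ZMod q)) (K : Matrix (Fin m) (Fin n) (ZMod q)),
      (∑ ω, w ω * if ∃ u ∈ A ω, H.mulVec u = 0 then (0 : ℝ) else 1) +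
      (∑ ω, w ω * if ∃ u ∈ T, u ≠ Q H ω ∧ H.mulVec u = 0 ∧ K.mulVec u = K.mulVec (Q H ω)
        then (1 : ℝ) else 0) +
      (∑ z, r z * if ∃ u ∈ T, u ≠ z ∧ H.mulVec (u - z) = 0 ∧ K.mulVec u = K.mulVec z
        then (1 : ℝ) else 0) ≤
      (∑ ω, Gᶜ.indicator w ω + if k = 0 then 0 else q * (q : ℝ) ^ k / N) +
        2 * (T.card / (q : ℝ) ^ (k + m)) := by
  set B : ℝ := (∑ ω, Gᶜ.indicator w ω + if k = 0 then 0 else q * (q : ℝ) ^ k / N) +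
        2 * (T.card / (q : ℝ) ^ (k + m)) with hB
  have h1 := sum_weight_not_covered_le (k := k) hw A (fun ω u hu => hT u (hA ω hu)) G hN hG
  have h2 := sum_sum_weight_exists_le (m := m) hw T (fun _ u => u) Q
    (fun ω u hu h => absurd h (hT u hu))
  have h3 := sum_sum_weight_exists_le (k := k) (m := m) hr T (fun z u => u - z) (fun _ z => z)
    (fun ω u hu h _ => sub_eq_zero.1 h)
  -- Averaging: if every pair exceeded the bound, then so would the sum over all pairs, against the
  -- three estimates above.
  by_contra! hcon
  have hne : (Finset.univ : Finset (Matrix (Fin k) (Fin n) (ZMod q))).Nonempty :=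
    Finset.univ_nonempty
  have hne' : (Finset.univ : Finset (Matrix (Fin m) (Fin n) (ZMod q))).Nonempty :=
    Finset.univ_nonempty
  have h4 := Finset.sum_lt_sum_of_nonempty hne fun H _ =>
    Finset.sum_lt_sum_of_nonempty hne' fun K _ => hcon H K
  simp only [Finset.sum_add_distrib, Finset.sum_const, Finset.card_univ, nsmul_eq_mul] at h4
  rw [← Finset.mul_sum] at h4
  have h5 := mul_le_mul_of_nonneg_left h1
    (Nat.cast_nonneg (α := ℝ) (Fintype.card (Matrix (Fin m) (Fin n) (ZMod q))))
  rw [hB] at h4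
  linarith

end RandomNested

/-! ### Joint typicality and conditional counts. -/

section Joint

theorem margFst_joint {X Z : Type*} [Fintype Z] {P : X → ℝ} {W : X → Z → ℝ}
    (hW : ∀ x, W x ∈ stdSimplex ℝ Z) : margFst (joint P W) = P := by
  funext x
  simp only [margFst, joint, ← Finset.mul_sum, (hW _).2, mul_one]

theorem NestedCodes.IsTypical.snd {X Z : Type*} [Fintype X] {n : ℕ} {J : X × Z → ℝ} (hJ : ∀ z, 0 ≤ J z) {δ : ℝ} {x : Fin n → X}
    {u : Fin n → Z} (h : IsTypical J δ fun i => (x i, u i)) :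
    IsTypical (margSnd J) (Fintype.card X * δ) u := by
  classical
  intro b
  constructor
  -- A marginal deviation is a sum of `Fintype.card X` joint deviations, whence the factor in the
  -- tolerance.
  · have h1 : (({i | u i = b} : Set (Fin n)).ncard : ℝ) / n - margSnd J b =
        ∑ a, ((({i | (x i, u i) = (a, b)} : Set (Fin n)).ncard : ℝ) / n - J (a, b)) := by
      rw [Finset.sum_sub_distrib, ← Finset.sum_div]
      congr 2
      have h2 : ∀ a, (({i | (x i, u i) = (a, b)} : Set (Fin n)).ncard : ℝ) =
          ∑ i, if (x i, u i) = (a, b) then 1 else 0 := fun a =>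
        ncard_eq_sum_ite (fun i => (x i, u i)) (a, b)
      simp only [h2]
      rw [ncard_eq_sum_ite, Finset.sum_comm]
      refine Finset.sum_congr rfl fun i _ => ?_
      by_cases hb : u i = b <;> simp [hb, Prod.ext_iff]
    rw [h1]
    refine (Finset.abs_sum_le_sum_abs _ _).trans ?_
    refine (Finset.sum_le_sum fun a _ => (h (a, b)).1).trans (le_of_eq ?_)
    simp
  · intro hb i hi
    have h0 : J (x i, b) = 0 :=
      (Finset.sum_eq_zero_iff_of_nonneg fun a _ => hJ (a, b)).1 hb (x i) (Finset.mem_univ _)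
    exact (h (x i, b)).2 h0 i (Prod.ext rfl hi)

variable {X Z : Type*} [Fintype X] [Fintype Z] {P : X → ℝ} {W : X → Z → ℝ} {n : ℕ}

theorem joint_mem_stdSimplex (hP : P ∈ stdSimplex ℝ X) (hW : ∀ x, W x ∈ stdSimplex ℝ Z) :
    joint P W ∈ stdSimplex ℝ (X × Z) := by
  refine ⟨fun z => mul_nonneg (hP.1 _) ((hW _).1 _), ?_⟩
  rw [Fintype.sum_prod_type]
  simp only [joint, ← Finset.mul_sum, (hW _).2, mul_one, hP.2]

theorem margSnd_mem_stdSimplex {J : X × Z → ℝ} (hJ : J ∈ stdSimplex ℝ (X × Z)) :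
    margSnd J ∈ stdSimplex ℝ Z := by
  refine ⟨fun z => Finset.sum_nonneg fun _ _ => hJ.1 _, ?_⟩
  rw [← hJ.2, Fintype.sum_prod_type, Finset.sum_comm]
  rfl

/-- Conditioning on the source word: given `x`, the output letters are independent with laws `W (x
i)`. -/
theorem blockProb_joint (A : Set (Fin n → X × Z)) [DecidablePred (· ∈ A)] :
    blockProb (joint P W) A = ∑ x : Fin n → X, (∏ i, P (x i)) *
      ∑ u : Fin n → Z, if (fun i => (x i, u i)) ∈ A then ∏ i, W (x i) (u i) else 0 := by
  unfold blockProb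
  rw [← (Equiv.arrowProdEquivProdArrow (Fin n) (fun _ => X) (fun _ => Z)).symm.sum_comp,
    Fintype.sum_prod_type]
  refine Finset.sum_congr rfl fun x _ => ?_
  rw [Finset.mul_sum]
  refine Finset.sum_congr rfl fun u _ => ?_
  by_cases h : (fun i => (x i, u i)) ∈ A
  · rw [if_pos h, ← Finset.prod_mul_distrib]
    exact Set.indicator_of_mem h _
  · rw [if_neg h, mul_zero]
    exact Set.indicator_of_notMem h _

open Classical in
/-- Source sequences which, with conditional probability at least `1 / 2`, are jointly typical
with the output of the channel. -/
def wellCovered (P : X → ℝ) (W : X → Z → ℝ) (δ : ℝ) (n : ℕ) : Set (Fin n → X) :=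
  {x | 1 / 2 ≤ ∑ u : Fin n → Z,
    if IsTypical (joint P W) δ (fun i => (x i, u i)) then ∏ i, W (x i) (u i) else 0}

/-- Markov's inequality: outside the well-covered set the conditional probability of atypicality
exceeds `1 / 2`. -/
theorem blockProb_compl_wellCovered_le (hP : P ∈ stdSimplex ℝ X)
    (hW : ∀ x, W x ∈ stdSimplex ℝ Z) (δ : ℝ) :
    blockProb P (wellCovered P W δ n)ᶜ ≤
      2 * blockProb (joint P W) {z : Fin n → X × Z | IsTypical (joint P W) δ z}ᶜ := by
  classical
  rw [blockProb_joint, blockProb, Finset.mul_sum]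
  refine Finset.sum_le_sum fun x _ => ?_
  have h0 := prod_law_nonneg hP.1 x
  have hS : (∑ u : Fin n → Z,
      if IsTypical (joint P W) δ (fun i => (x i, u i)) then ∏ i, W (x i) (u i) else 0) +
      (∑ u : Fin n → Z, if (fun i => (x i, u i)) ∈
        {z : Fin n → X × Z | IsTypical (joint P W) δ z}ᶜ then ∏ i, W (x i) (u i) else 0) = 1 := by
    rw [← Finset.sum_add_distrib]
    have h1 : ∑ u : Fin n → Z, ∏ i, W (x i) (u i) = 1 := by
      have h := Finset.prod_univ_sum (fun _ : Fin n => (Finset.univ : Finset Z))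
        (fun i a => W (x i) a)
      rw [Fintype.piFinset_univ] at h
      rw [← h]
      simp [(hW _).2]
    rw [← h1]
    refine Finset.sum_congr rfl fun u _ => ?_
    by_cases h : IsTypical (joint P W) δ (fun i => (x i, u i)) <;> simp [h]
  have hS0 : 0 ≤ ∑ u : Fin n → Z, if (fun i => (x i, u i)) ∈
        {z : Fin n → X × Z | IsTypical (joint P W) δ z}ᶜ then ∏ i, W (x i) (u i) else 0 :=
    Finset.sum_nonneg fun u _ => by
      have := Finset.prod_nonneg fun i (_ : i ∈ Finset.univ) => (hW (x i)).1 (u i)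
      split_ifs <;> first | exact this | exact le_rfl
  by_cases hx : x ∈ wellCovered P W δ n
  · rw [Set.indicator_of_notMem (by simpa using hx)]
    exact mul_nonneg zero_le_two (mul_nonneg h0 hS0)
  · rw [Set.indicator_of_mem (by simpa using hx)]
    rw [wellCovered, Set.mem_ofPred_eq, not_le] at hx
    nlinarith

theorem condEntropy_joint (hW : ∀ x, W x ∈ stdSimplex ℝ Z) :
    condEntropy (joint P W) = -∑ z, joint P W z * Real.log (W z.1 z.2) := by
  rw [condEntropy, Fintype.sum_prod_type, margFst_joint hW, ← Finset.sum_neg_distrib]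
  refine Finset.sum_congr rfl fun a _ => ?_
  rw [← Finset.sum_neg_distrib]
  refine Finset.sum_congr rfl fun b _ => ?_
  by_cases ha : P a = 0
  · simp [joint, ha]
  · simp [joint, mul_div_cancel_left₀ _ ha]

open Classical in
/-- A well-covered sequence is jointly typical with `exp (n (H(Z|X) - δ L)) / 2` sequences. -/
theorem card_typical_ge_of_mem_wellCovered (hP : P ∈ stdSimplex ℝ X)
    (hW : ∀ x, W x ∈ stdSimplex ℝ Z) {δ : ℝ} {x : Fin n → X} (hx : x ∈ wellCovered P W δ n) :
    Real.exp (n * (condEntropy (joint P W) - δ * ∑ z : X × Z, |Real.log (W z.1 z.2)|)) / 2 ≤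
      (Finset.univ.filter fun u : Fin n → Z =>
        IsTypical (joint P W) δ fun i => (x i, u i)).card := by
  -- Each jointly typical `u` has at most this conditional probability, while together they have at
  -- least `1 / 2`.
  have hup : ∀ u : Fin n → Z, IsTypical (joint P W) δ (fun i => (x i, u i)) →
      ∏ i, W (x i) (u i) ≤
      Real.exp (-(n * (condEntropy (joint P W) - δ * ∑ z : X × Z, |Real.log (W z.1 z.2)|))) := by
    intro u hu
    have hpos : ∀ i, 0 < W (x i) (u i) := fun i =>
      pos_of_mul_pos_right (hu.pos (joint_mem_stdSimplex hP hW).1 i) (hP.1 _)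
    have h1 : ∏ i, W (x i) (u i) = Real.exp (∑ i, Real.log (W (x i) (u i))) := by
      rw [Real.exp_sum]
      exact Finset.prod_congr rfl fun i _ => (Real.exp_log (hpos i)).symm
    have h2 := (abs_le.1 (hu.abs_sum_sub_le fun z => Real.log (W z.1 z.2))).2
    rw [h1, Real.exp_le_exp, condEntropy_joint hW]
    simp only at h2
    linarith
  have h1 : (1 : ℝ) / 2 ≤ _ := hx
  rw [← Finset.sum_filter] at h1
  have h2 := h1.trans (Finset.sum_le_sum fun u hu => hup u (Finset.mem_filter.1 hu).2)
  rw [Finset.sum_const, nsmul_eq_mul, Real.exp_neg, ← div_eq_mul_inv,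
    le_div_iff₀ (Real.exp_pos _)] at h2
  linarith

end Joint

/-! ### Codes and schemes at a fixed block length. -/

section FiniteBlocklength

open Classical in
theorem blockProb_eq_sum_ite {α : Type*} [Fintype α] {p : α → ℝ} {n : ℕ} (A : Set (Fin n → α)) :
    blockProb p A = ∑ x : Fin n → α, (∏ i, p (x i)) * if x ∈ A then 1 else 0 := by
  refine Finset.sum_congr rfl fun x _ => ?_
  by_cases hx : x ∈ A <;> simp [hx]

variable {q : ℕ} {X : Type*}

/-- Any nested linear code admits a scheme. -/
theorem nonempty_scheme {n : ℕ} (C : NestedLinearCode q n) : Nonempty (C.Scheme X) := by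
  classical
  let l : (Fin C.m → ZMod q) → (Fin n → ZMod q) := fun s =>
    if h : ∃ u ∈ C.fine, C.ΔH.mulVec u = s then h.choose else 0
  refine ⟨⟨fun _ => 0, fun _ => C.fine.zero_mem, l, fun s => ?_, fun u hu => ?_⟩⟩
  · by_cases h : ∃ u ∈ C.fine, C.ΔH.mulVec u = s
    · simp only [l, dif_pos h]; exact h.choose_spec.1
    · simp only [l, dif_neg h]; exact C.fine.zero_mem
  · have h : ∃ v ∈ C.fine, C.ΔH.mulVec v = C.ΔH.mulVec u := ⟨u, hu, rfl⟩
    simp only [l, dif_pos h]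
    rw [C.mem_coarse, Matrix.mulVec_sub, h.choose_spec.2, sub_self]
    exact ⟨C.fine.sub_mem h.choose_spec.1 hu, rfl⟩

/-- Random coding applied to typical sets. The error terms come from badly covered source words,
failure of covering, and collisions; the last are counted twice, once for the coset decoder and once
for the syndrome property of the coarse code. The assumption on the zero word sits inside the
conclusion so that a code can be chosen for every `n`. -/
theorem exists_scheme [Fact q.Prime] [Fintype X] {P : X → ℝ} (hP : P ∈ stdSimplex ℝ X) {W : X → ZMod q → ℝ}
    (hW : ∀ x, W x ∈ stdSimplex ℝ (ZMod q)) (n k m : ℕ) (δ : ℝ) :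
    ∃ (C : NestedLinearCode q n) (T : C.Scheme X), C.k₁ = k ∧ C.m = m ∧
      (¬ IsTypical (margSnd (joint P W)) (Fintype.card X * δ) (0 : Fin n → ZMod q) →
        blockProb P {x : Fin n → X |
          IsTypical (joint P W) δ (fun i => (x i, T.quantize x i)) ∧
            T.decoded x = T.quantize x}ᶜ +
        blockProb (margSnd (joint P W)) {z : Fin n → ZMod q | ∃ u, u ≠ z ∧
          IsTypical (margSnd (joint P W)) (Fintype.card X * δ) u ∧
            C.H₂.mulVec u = C.H₂.mulVec z} ≤
        2 * blockProb (joint P W)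
            {z : Fin n → X × ZMod q | IsTypical (joint P W) δ z}ᶜ +
          (if k = 0 then 0 else q * (q : ℝ) ^ k / (Real.exp (n * (condEntropy (joint P W) -
            δ * ∑ z : X × ZMod q, |Real.log (W z.1 z.2)|)) / 2)) +
          2 * (({u | IsTypical (margSnd (joint P W)) (Fintype.card X * δ) u} :
            Set (Fin n → ZMod q)).ncard / (q : ℝ) ^ (k + m))) := by
  classical
  by_cases h0 : IsTypical (margSnd (joint P W)) (Fintype.card X * δ) (0 : Fin n → ZMod q)
  · exact ⟨⟨k, m, 0, 0⟩, (nonempty_scheme _).some, rfl, rfl, fun h => absurd h0 h⟩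
  have hJ := joint_mem_stdSimplex hP hW
  have hp := margSnd_mem_stdSimplex hJ
  set J := joint P W with hJdef
  set p := margSnd J with hpdef
  set δ' := Fintype.card X * δ with hδ'
  let A : (Fin n → X) → Finset (Fin n → ZMod q) := fun x =>
    Finset.univ.filter fun u => IsTypical J δ fun i => (x i, u i)
  let T : Finset (Fin n → ZMod q) := Finset.univ.filter fun u => IsTypical p δ' u
  have hT : ∀ u ∈ T, u ≠ 0 := by
    rintro u hu rfl
    exact h0 (Finset.mem_filter.1 hu).2
  have hAT : ∀ x, A x ⊆ T := fun x u hu =>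
    Finset.mem_filter.2 ⟨Finset.mem_univ _, ((Finset.mem_filter.1 hu).2).snd hJ.1⟩
  -- The quantizer is defined for every `H` before the matrices are drawn, and does not see `K`. The
  -- default `0` stays in the fine code.
  let Q : Matrix (Fin k) (Fin n) (ZMod q) → (Fin n → X) → Fin n → ZMod q := fun H x =>
    if h : ∃ u ∈ A x, H.mulVec u = 0 then h.choose else 0
  have hQ0 : ∀ (H : Matrix (Fin k) (Fin n) (ZMod q)) x, H.mulVec (Q H x) = 0 := by
    intro H x
    by_cases h : ∃ u ∈ A x, H.mulVec u = 0
    · simp only [Q, dif_pos h]; exact h.choose_spec.2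
    · simp only [Q, dif_neg h, Matrix.mulVec_zero]
  have hQA : ∀ (H : Matrix (Fin k) (Fin n) (ZMod q)) x, (∃ u ∈ A x, H.mulVec u = 0) → Q H x ∈ A x := by
    intro H x h
    simp only [Q, dif_pos h]; exact h.choose_spec.1
  obtain ⟨H, K, hHK⟩ := exists_nested_matrices (k := k) (m := m)
    (w := fun x : Fin n → X => ∏ i, P (x i)) ⟨prod_law_nonneg hP.1, sum_prod_law hP n⟩
    (r := fun z : Fin n → ZMod q => ∏ i, p (z i)) ⟨prod_law_nonneg hp.1, sum_prod_law hp n⟩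
    T hT A hAT (wellCovered P W δ n) (half_pos (Real.exp_pos _))
    (fun x hx => card_typical_ge_of_mem_wellCovered hP hW hx) Q
  let C : NestedLinearCode q n := ⟨k, m, H, K⟩
  have hfine : ∀ u, u ∈ C.fine ↔ H.mulVec u = 0 := fun u => LinearMap.mem_ker
  -- The leader is a typical word of the coset if there is one. Otherwise any word of the fine code
  -- with that syndrome serves, and `0` for messages that are not syndromes of fine codewords.
  let l : (Fin m → ZMod q) → (Fin n → ZMod q) := fun s =>
    if h : ∃ u ∈ T, H.mulVec u = 0 ∧ K.mulVec u = s then h.choose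
    else if h : ∃ u, H.mulVec u = 0 ∧ K.mulVec u = s then h.choose else 0
  have hl0 : ∀ s, H.mulVec (l s) = 0 := by
    intro s
    by_cases h : ∃ u ∈ T, H.mulVec u = 0 ∧ K.mulVec u = s
    · simp only [l, dif_pos h]; exact h.choose_spec.2.1
    · by_cases h' : ∃ u, H.mulVec u = 0 ∧ K.mulVec u = s
      · simp only [l, dif_neg h, dif_pos h']; exact h'.choose_spec.1
      · simp only [l, dif_neg h, dif_neg h', Matrix.mulVec_zero]
  have hlK : ∀ u, H.mulVec u = 0 → K.mulVec (l (K.mulVec u)) = K.mulVec u := by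
    intro u hu
    by_cases h : ∃ v ∈ T, H.mulVec v = 0 ∧ K.mulVec v = K.mulVec u
    · simp only [l, dif_pos h]; exact h.choose_spec.2.2
    · have h' : ∃ v, H.mulVec v = 0 ∧ K.mulVec v = K.mulVec u := ⟨u, hu, rfl⟩
      simp only [l, dif_neg h, dif_pos h']; exact h'.choose_spec.2
  have hlT : ∀ u ∈ T, H.mulVec u = 0 → l (K.mulVec u) ∈ T := by
    intro u hu hHu
    have h : ∃ v ∈ T, H.mulVec v = 0 ∧ K.mulVec v = K.mulVec u := ⟨u, hu, hHu, rfl⟩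
    simp only [l, dif_pos h]; exact h.choose_spec.1
  let S : C.Scheme X :=
    { quantize := Q H
      quantize_mem := fun x => (hfine _).2 (hQ0 H x)
      leader := l
      leader_mem := fun s => (hfine _).2 (hl0 s)
      leader_coset := fun u hu => by
        rw [C.mem_coarse]
        refine ⟨C.fine.sub_mem ((hfine _).2 (hl0 _)) hu, ?_⟩
        change K.mulVec (l (K.mulVec u) - u) = 0
        rw [Matrix.mulVec_sub, hlK u ((hfine u).1 hu), sub_self] }
  refine ⟨C, S, rfl, rfl, fun _ => ?_⟩
  -- An error means that no typical word covers `x`, or that the leader, itself typical, differs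
  -- from the quantized word in its coset.
  have hbad1 : blockProb P {x : Fin n → X | IsTypical J δ (fun i => (x i, S.quantize x i)) ∧
            S.decoded x = S.quantize x}ᶜ ≤
      (∑ x : Fin n → X, (∏ i, P (x i)) * if ∃ u ∈ A x, H.mulVec u = 0 then (0 : ℝ) else 1) +
      (∑ x : Fin n → X, (∏ i, P (x i)) * if ∃ u ∈ T, u ≠ Q H x ∧ H.mulVec u = 0 ∧
        K.mulVec u = K.mulVec (Q H x) then (1 : ℝ) else 0) := by
    rw [blockProb_eq_sum_ite, ← Finset.sum_add_distrib]
    refine Finset.sum_le_sum fun x _ => ?_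
    rw [← mul_add]
    refine mul_le_mul_of_nonneg_left ?_ (prod_law_nonneg hP.1 x)
    by_cases hc : ∃ u ∈ A x, H.mulVec u = 0
    · rw [if_pos hc, zero_add]
      by_cases hx : ∃ u ∈ T, u ≠ Q H x ∧ H.mulVec u = 0 ∧ K.mulVec u = K.mulVec (Q H x)
      · rw [if_pos hx]; split_ifs <;> norm_num
      · rw [if_neg hx, if_neg]
        have hQm := hQA H x hc
        refine not_not.2 ⟨(Finset.mem_filter.1 hQm).2, ?_⟩
        by_contra hne
        exact hx ⟨l (K.mulVec (Q H x)), hlT _ (hAT x hQm) (hQ0 H x), hne, hl0 _,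
          hlK _ (hQ0 H x)⟩
    · rw [if_neg hc]
      split_ifs <;> norm_num
  have hbad2 : blockProb p {z : Fin n → ZMod q | ∃ u, u ≠ z ∧
          IsTypical p δ' u ∧ C.H₂.mulVec u = C.H₂.mulVec z} ≤
      ∑ z : Fin n → ZMod q, (∏ i, p (z i)) * if ∃ u ∈ T, u ≠ z ∧ H.mulVec (u - z) = 0 ∧
        K.mulVec u = K.mulVec z then (1 : ℝ) else 0 := by
    rw [blockProb_eq_sum_ite]
    refine Finset.sum_le_sum fun z _ => ?_
    refine mul_le_mul_of_nonneg_left ?_ (prod_law_nonneg hp.1 z)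
    by_cases hz : z ∈ {z : Fin n → ZMod q | ∃ u, u ≠ z ∧
          IsTypical p δ' u ∧ C.H₂.mulVec u = C.H₂.mulVec z}
    · rw [if_pos hz, if_pos]
      obtain ⟨u, hne, hu, hH⟩ := hz
      have hc : u - z ∈ C.coarse := by
        change C.H₂.mulVec (u - z) = 0
        rw [Matrix.mulVec_sub, hH, sub_self]
      rw [C.mem_coarse] at hc
      have hK : K.mulVec (u - z) = 0 := hc.2
      rw [Matrix.mulVec_sub, sub_eq_zero] at hK
      exact ⟨u, Finset.mem_filter.2 ⟨Finset.mem_univ _, hu⟩, hne, (hfine _).1 hc.1, hK⟩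
    · rw [if_neg hz]
      split_ifs <;> norm_num
  have hwell := blockProb_compl_wellCovered_le (n := n) hP hW δ
  have hcard : (({u | IsTypical p δ' u} : Set (Fin n → ZMod q)).ncard : ℝ) = T.card := by
    rw [Set.ncard_eq_toFinset_card']
    congr 2
    ext u
    simp [T]
  rw [hcard]
  change _ ≤ (blockProb P (wellCovered P W δ n)ᶜ + _) + _ at hHK
  linarith

end FiniteBlocklength

/-! ### Entropy identities and existence of the minimum. -/

section Information

variable {X Z : Type*} [Fintype X] [Fintype Z]

theorem condEntropy_eq {J : X × Z → ℝ} (hJ : ∀ z, 0 ≤ J z) :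
    condEntropy J = entropy J - entropy (margFst J) := by
  have h : ∀ a b, -(J (a, b) * Real.log (J (a, b) / margFst J a)) =
      Real.negMulLog (J (a, b)) + J (a, b) * Real.log (margFst J a) := by
    intro a b
    rcases (hJ (a, b)).eq_or_lt with h0 | h0
    · simp [← h0]
    · have h1 : 0 < margFst J a :=
        h0.trans_le (Finset.single_le_sum (f := fun b => J (a, b)) (fun b _ => hJ (a, b))
          (Finset.mem_univ b))
      rw [Real.log_div h0.ne' h1.ne', Real.negMulLog]
      ring
  simp only [condEntropy, entropy, h, Finset.sum_add_distrib, ← Finset.sum_mul]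
  rw [Fintype.sum_prod_type, sub_eq_add_neg, ← Finset.sum_neg_distrib]
  congr 1
  refine Finset.sum_congr rfl fun a _ => ?_
  rw [Real.negMulLog, neg_mul, neg_neg]
  rfl

/-- Wherever `J` is positive both marginals are, so the logarithm splits. This identity matches `k₂
- k₁` with the rate. -/
theorem mutualInfo_eq {J : X × Z → ℝ} (hJ : ∀ z, 0 ≤ J z) :
    mutualInfo J = entropy (margSnd J) - condEntropy J := by
  have h : ∀ a b, J (a, b) * Real.log (J (a, b) / (margFst J a * margSnd J b)) =
      -(J (a, b) * Real.log (margSnd J b)) -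
        -(J (a, b) * Real.log (J (a, b) / margFst J a)) := by
    intro a b
    rcases (hJ (a, b)).eq_or_lt with h0 | h0
    · simp [← h0]
    · have h1 : 0 < margFst J a :=
        h0.trans_le (Finset.single_le_sum (f := fun b => J (a, b)) (fun b _ => hJ (a, b))
          (Finset.mem_univ b))
      have h2 : 0 < margSnd J b :=
        h0.trans_le (Finset.single_le_sum (f := fun a => J (a, b)) (fun a _ => hJ (a, b))
          (Finset.mem_univ a))
      rw [← div_div, Real.log_div (div_pos h0 h1).ne' h2.ne']
      ring
  simp only [mutualInfo, h, Finset.sum_sub_distrib]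
  rw [condEntropy, entropy, Finset.sum_comm]
  congr 1
  refine Finset.sum_congr rfl fun b _ => ?_
  rw [Real.negMulLog, Finset.sum_neg_distrib, ← Finset.sum_mul, neg_mul]
  rfl

theorem mutualInfo_nonneg {J : X × Z → ℝ} (hJ : J ∈ stdSimplex ℝ (X × Z)) :
    0 ≤ mutualInfo J := by
  -- The termwise form of `log t ≥ 1 - 1 / t`; the left sides sum to zero.
  have h : ∀ a b, J (a, b) - margFst J a * margSnd J b ≤
      J (a, b) * Real.log (J (a, b) / (margFst J a * margSnd J b)) := by
    intro a b
    have ha : 0 ≤ margFst J a := Finset.sum_nonneg fun _ _ => hJ.1 _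
    have hb : 0 ≤ margSnd J b := Finset.sum_nonneg fun _ _ => hJ.1 _
    rcases (hJ.1 (a, b)).eq_or_lt with h0 | h0
    · simpa [← h0] using mul_nonneg ha hb
    · have h1 : 0 < margFst J a :=
        h0.trans_le (Finset.single_le_sum (f := fun b => J (a, b)) (fun b _ => hJ.1 (a, b))
          (Finset.mem_univ b))
      have h2 : 0 < margSnd J b :=
        h0.trans_le (Finset.single_le_sum (f := fun a => J (a, b)) (fun a _ => hJ.1 (a, b))
          (Finset.mem_univ a))
      have h3 := Real.one_sub_inv_le_log_of_pos (div_pos h0 (mul_pos h1 h2))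
      have h4 := mul_le_mul_of_nonneg_left h3 h0.le
      rw [inv_div, mul_sub, mul_one, mul_div_cancel₀ _ h0.ne'] at h4
      exact h4
  have h1 : ∑ a, margFst J a = 1 := by rw [← hJ.2, Fintype.sum_prod_type]; rfl
  have h2 : ∑ b, margSnd J b = 1 := (margSnd_mem_stdSimplex hJ).2
  have h3 : ∑ a, ∑ b, J (a, b) = 1 := by rw [← hJ.2, Fintype.sum_prod_type]
  calc (0 : ℝ) = ∑ a, ∑ b, (J (a, b) - margFst J a * margSnd J b) := by
        simp only [Finset.sum_sub_distrib, h3, ← Finset.mul_sum, h2, mul_one, h1, sub_self]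
    _ ≤ _ := Finset.sum_le_sum fun a _ => Finset.sum_le_sum fun b _ => h a b

theorem condEntropy_joint_nonneg {P : X → ℝ} {W : X → Z → ℝ} (hP : P ∈ stdSimplex ℝ X)
    (hW : ∀ x, W x ∈ stdSimplex ℝ Z) : 0 ≤ condEntropy (joint P W) := by
  rw [condEntropy_joint hW, neg_nonneg]
  refine Finset.sum_nonpos fun z _ => mul_nonpos_of_nonneg_of_nonpos
    ((joint_mem_stdSimplex hP hW).1 z) (Real.log_nonpos ((hW _).1 _) ?_)
  rw [← (hW z.1).2]
  exact Finset.single_le_sum (fun b _ => (hW z.1).1 b) (Finset.mem_univ _)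

/-- The minimum in the definition of the rate-distortion function is attained. -/
theorem isLeast_rateDistortion {P : X → ℝ} (hP : P ∈ stdSimplex ℝ X) (d : X → Z → ℝ) (D : ℝ)
    (hD : ∃ W, IsFeasible P d D W) :
    IsLeast (feasibleRates P d D) (rateDistortion P d D) := by
  have hK : IsCompact {W : X → Z → ℝ | IsFeasible P d D W} := by
    have h1 : IsCompact (Set.univ.pi fun _ : X => stdSimplex ℝ Z) :=
      isCompact_univ_pi fun _ => isCompact_stdSimplex ℝ Z
    have h2 : IsClosed {W : X → Z → ℝ | ∑ x, ∑ y, joint P W (x, y) * d x y ≤ D} := by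
      refine isClosed_le ?_ continuous_const
      simp only [joint]
      fun_prop
    convert h1.inter_right h2 using 1
    ext W
    simp [IsFeasible]
  have hc : ContinuousOn (fun W : X → Z → ℝ => mutualInfo (joint P W))
      {W | IsFeasible P d D W} := by
    -- Quotients inside logarithms obscure continuity at the boundary of the simplex; in terms of
    -- `Real.negMulLog` it is immediate.
    have hcont : Continuous fun W : X → Z → ℝ =>
        entropy (margSnd (joint P W)) - (entropy (joint P W) - entropy (margFst (joint P W))) := by
      have hn := Real.continuous_negMulLog
      simp only [entropy, margSnd, margFst, joint]
      fun_prop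
    refine hcont.continuousOn.congr fun W hW => ?_
    have hJ := (joint_mem_stdSimplex hP hW.1).1
    simp only [mutualInfo_eq hJ, condEntropy_eq hJ]
  obtain ⟨W, hW, hmin⟩ := hK.exists_isMinOn hD hc
  have hleast : IsLeast (feasibleRates P d D) (mutualInfo (joint P W)) := by
    refine ⟨⟨W, hW, rfl⟩, ?_⟩
    rintro _ ⟨V, hV, rfl⟩
    exact hmin hV
  rw [rateDistortion, hleast.csInf_eq]
  exact hleast

end Information

/-! ### Vanishing tolerances and limits of rates. -/

section Asymptotics

theorem tendsto_floor_mul_div {c : ℕ → ℝ} {l : ℝ} (hc : ∀ n, 0 ≤ c n)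
    (h : Tendsto c atTop (𝓝 l)) :
    Tendsto (fun n : ℕ => (⌊n * c n⌋₊ : ℝ) / n) atTop (𝓝 l) := by
  have h1 : Tendsto (fun n : ℕ => c n - 1 / (n : ℝ)) atTop (𝓝 l) := by
    simpa using h.sub tendsto_one_div_atTop_nhds_zero_nat
  refine tendsto_of_tendsto_of_tendsto_of_le_of_le' h1 h ?_ ?_
  · filter_upwards [eventually_gt_atTop 0] with n hn
    have hn' : (0 : ℝ) < n := Nat.cast_pos.2 hn
    have := Nat.lt_floor_add_one (n * c n)
    rw [le_div_iff₀ hn', sub_mul, one_div_mul_cancel hn'.ne']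
    linarith
  · filter_upwards [eventually_gt_atTop 0] with n hn
    have hn' : (0 : ℝ) < n := Nat.cast_pos.2 hn
    rw [div_le_iff₀ hn', mul_comm (c n)]
    exact Nat.floor_le (mul_nonneg hn'.le (hc n))

theorem tendsto_ceil_mul_div {c : ℕ → ℝ} {l : ℝ} (hc : ∀ n, 0 ≤ c n)
    (h : Tendsto c atTop (𝓝 l)) :
    Tendsto (fun n : ℕ => (⌈n * c n⌉₊ : ℝ) / n) atTop (𝓝 l) := by
  have h1 : Tendsto (fun n : ℕ => c n + 1 / (n : ℝ)) atTop (𝓝 l) := by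
    simpa using h.add tendsto_one_div_atTop_nhds_zero_nat
  refine tendsto_of_tendsto_of_tendsto_of_le_of_le' h h1 ?_ ?_
  · filter_upwards [eventually_gt_atTop 0] with n hn
    have hn' : (0 : ℝ) < n := Nat.cast_pos.2 hn
    rw [le_div_iff₀ hn', mul_comm (c n)]
    exact Nat.le_ceil _
  · filter_upwards [eventually_gt_atTop 0] with n hn
    have hn' : (0 : ℝ) < n := Nat.cast_pos.2 hn
    have := Nat.ceil_lt_add_one (mul_nonneg hn'.le (hc n))
    rw [div_le_iff₀ hn', add_mul, one_div_mul_cancel hn'.ne']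
    linarith

/-- The tolerance used at block length `n`. -/
noncomputable def tolerance (n : ℕ) : ℝ := (n : ℝ) ^ (-(1 / 4) : ℝ)

theorem tolerance_nonneg (n : ℕ) : 0 ≤ tolerance n := Real.rpow_nonneg (Nat.cast_nonneg n) _

theorem tolerance_pos {n : ℕ} (hn : 0 < n) : 0 < tolerance n :=
  Real.rpow_pos_of_pos (Nat.cast_pos.2 hn) _

theorem tendsto_tolerance : Tendsto tolerance atTop (𝓝 0) :=
  (tendsto_rpow_neg_atTop (by norm_num)).comp tendsto_natCast_atTop_atTop

/-- The exponent `-1/4` lies strictly between `-1/2` and `0`: the tolerance vanishes, yet slowly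
enough for the Chebyshev bound to vanish too. -/
theorem tendsto_mul_tolerance_sq : Tendsto (fun n : ℕ => n * tolerance n ^ 2) atTop atTop := by
  have h : Tendsto (fun n : ℕ => (n : ℝ) ^ (1 / 2 : ℝ)) atTop atTop :=
    (tendsto_rpow_atTop (by norm_num)).comp tendsto_natCast_atTop_atTop
  refine h.congr' ?_
  filter_upwards [eventually_gt_atTop 0] with n hn
  have hn' : (0 : ℝ) < n := Nat.cast_pos.2 hn
  rw [tolerance, ← Real.rpow_natCast, ← Real.rpow_mul hn'.le]
  nth_rewrite 2 [← Real.rpow_one (n : ℝ)]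
  rw [← Real.rpow_add hn']
  norm_num

theorem tendsto_mul_tolerance : Tendsto (fun n : ℕ => n * tolerance n) atTop atTop := by
  refine tendsto_atTop_mono' _ ?_ tendsto_mul_tolerance_sq
  filter_upwards [tendsto_tolerance.eventually_le_const one_pos] with n hn
  refine mul_le_mul_of_nonneg_left ?_ (Nat.cast_nonneg n)
  have := tolerance_nonneg n
  nlinarith

theorem tendsto_exp_neg_mul_tolerance :
    Tendsto (fun n : ℕ => Real.exp (-(n * tolerance n))) atTop (𝓝 0) :=
  Real.tendsto_exp_neg_atTop_nhds_zero.comp tendsto_mul_tolerance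

theorem tendsto_blockProb_not_typical {α : Type*} [Fintype α] {p : α → ℝ}
    (hp : p ∈ stdSimplex ℝ α) :
    Tendsto (fun n : ℕ => blockProb p {x : Fin n → α | IsTypical p (tolerance n) x}ᶜ) atTop
      (𝓝 0) := by
  have h : Tendsto (fun n : ℕ => Fintype.card α / (n * tolerance n ^ 2)) atTop (𝓝 0) :=
    tendsto_const_nhds.div_atTop tendsto_mul_tolerance_sq
  refine tendsto_of_tendsto_of_tendsto_of_le_of_le' tendsto_const_nhds h
    (Eventually.of_forall fun n => blockProb_nonneg hp.1 _) ?_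
  filter_upwards [eventually_gt_atTop 0] with n hn
  rw [blockProb_compl hp]
  linarith [blockProb_typical_ge hp (tolerance_pos hn) hn]

/-- Some nonzero letter has positive probability but frequency zero in the zero word; a small
tolerance detects this. -/
theorem eventually_zero_not_typical {q : ℕ} {p : ZMod q → ℝ} (h : NonRedundant p) (c : ℝ) :
    ∀ᶠ n : ℕ in atTop, ¬ IsTypical p (c * tolerance n) (0 : Fin n → ZMod q) := by
  obtain ⟨u, hu, hpu⟩ := h
  have h0 : Tendsto (fun n => c * tolerance n) atTop (𝓝 0) := by
    simpa using tendsto_tolerance.const_mul c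
  filter_upwards [h0.eventually_lt_const hpu] with n hn hT
  have h1 := (hT u).1
  have h2 : ({i | (0 : Fin n → ZMod q) i = u} : Set (Fin n)) = ∅ :=
    Set.eq_empty_of_forall_notMem fun i hi => hu hi.symm
  rw [h2, Set.ncard_empty, Nat.cast_zero, zero_div, zero_sub, abs_neg, abs_of_pos hpu] at h1
  linarith

variable {q : ℕ} [Fact q.Prime] {X : Type*} [Fintype X]

theorem pow_eq_exp_mul_log (k : ℕ) : (q : ℝ) ^ k = Real.exp (k * Real.log q) := by
  rw [← Real.log_pow, Real.exp_log]
  have : (0 : ℝ) < q := Nat.cast_pos.2 (Fact.out : q.Prime).pos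
  positivity

theorem log_prime_pos : 0 < Real.log q :=
  Real.log_pos (Nat.one_lt_cast.2 (Fact.out : q.Prime).one_lt)

/-- Good nested codes and schemes, for a test channel with outputs in `ℤ/q`. -/
theorem exists_scheme_sequence {P : X → ℝ} (hP : P ∈ stdSimplex ℝ X) {W : X → ZMod q → ℝ}
    (hW : ∀ x, W x ∈ stdSimplex ℝ (ZMod q)) (hnr : NonRedundant (margSnd (joint P W))) :
    ∃ (C : ∀ n, NestedLinearCode q n) (T : ∀ n, (C n).Scheme X),
      Tendsto (fun n : ℕ => ((C n).k₁ : ℝ) / n * Real.log q) atTop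
        (𝓝 (condEntropy (joint P W))) ∧
      Tendsto (fun n : ℕ => ((C n).k₂ : ℝ) / n * Real.log q) atTop
        (𝓝 (entropy (margSnd (joint P W)))) ∧
      Tendsto (fun n : ℕ => blockProb P {x : Fin n → X |
          IsTypical (joint P W) (tolerance n) (fun i => (x i, (T n).quantize x i)) ∧
            (T n).decoded x = (T n).quantize x}ᶜ) atTop (𝓝 0) ∧
      Tendsto (fun n : ℕ => blockProb (margSnd (joint P W)) {z : Fin n → ZMod q | ∃ u, u ≠ z ∧
          IsTypical (margSnd (joint P W)) (Fintype.card X * tolerance n) u ∧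
            (C n).H₂.mulVec u = (C n).H₂.mulVec z}) atTop (𝓝 0) := by
  have hJ := joint_mem_stdSimplex hP hW
  have hp := margSnd_mem_stdSimplex hJ
  have hc0 := condEntropy_joint_nonneg hP hW
  have hle : condEntropy (joint P W) ≤ entropy (margSnd (joint P W)) := by
    have h1 := mutualInfo_nonneg hJ
    rw [mutualInfo_eq hJ.1] at h1
    linarith
  set J := joint P W with hJdef
  set p := margSnd J with hpdef
  have hlog : 0 < Real.log q := log_prime_pos
  have hq : (0 : ℝ) < q := Nat.cast_pos.2 (Fact.out : q.Prime).pos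
  set L : ℝ := Fintype.card X * ∑ a, |Real.log (p a)| with hL
  set L' : ℝ := ∑ z : X × ZMod q, |Real.log (W z.1 z.2)| with hL'
  have hL0 : 0 ≤ L := by positivity
  -- The terms with `L'` and `L` absorb the errors in the typical-set counts; the extra `1` in each
  -- leaves a factor `exp (-(n * tolerance n))`.
  let c : ℕ → ℝ := fun n => max (condEntropy J - (L' + 1) * tolerance n) 0 / Real.log q
  let c' : ℕ → ℝ := fun n => (entropy p + (L + 1) * tolerance n) / Real.log q
  have hcn : ∀ n, 0 ≤ c n := fun n => by positivity
  have hcn' : ∀ n, 0 ≤ c' n := fun n => by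
    have := tolerance_nonneg n
    have := hc0.trans hle
    positivity
  have hct : Tendsto c atTop (𝓝 (condEntropy J / Real.log q)) := by
    have h := ((tendsto_const_nhds (x := condEntropy J)).sub
      (tendsto_tolerance.const_mul (L' + 1))).max (tendsto_const_nhds (x := (0 : ℝ)))
    rw [mul_zero, sub_zero, max_eq_left hc0] at h
    exact h.div_const _
  have hct' : Tendsto c' atTop (𝓝 (entropy p / Real.log q)) := by
    have h := (tendsto_const_nhds (x := entropy p)).add
      (tendsto_tolerance.const_mul (L + 1))
    rw [mul_zero, add_zero] at h
    exact h.div_const _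
  let k : ℕ → ℕ := fun n => ⌊n * c n⌋₊
  let k' : ℕ → ℕ := fun n => ⌈n * c' n⌉₊
  -- The subtraction truncates, so `k₂` is `max (k n) (k' n)`. Its normalized limit is still the
  -- entropy, since `condEntropy J ≤ entropy p`.
  choose C T hk hm hCT using fun n => exists_scheme hP hW n (k n) (k' n - k n) (tolerance n)
  have hlimk : Tendsto (fun n : ℕ => (k n : ℝ) / n * Real.log q) atTop (𝓝 (condEntropy J)) := by
    have h := (tendsto_floor_mul_div hcn hct).mul_const (Real.log q)
    rwa [div_mul_cancel₀ _ hlog.ne'] at h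
  have hlimk' : Tendsto (fun n : ℕ => (k' n : ℝ) / n * Real.log q) atTop (𝓝 (entropy p)) := by
    have h := (tendsto_ceil_mul_div hcn' hct').mul_const (Real.log q)
    rwa [div_mul_cancel₀ _ hlog.ne'] at h
  have hk2 : ∀ n, (C n).k₂ = max (k n) (k' n) := fun n => by
    rw [NestedLinearCode.k₂, hk, hm, add_tsub_eq_max]
  have hcov : ∀ n : ℕ, (if k n = 0 then 0 else q * (q : ℝ) ^ k n /
      (Real.exp (n * (condEntropy J - tolerance n * L')) / 2)) ≤
      2 * q * Real.exp (-(n * tolerance n)) := by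
    intro n
    split_ifs with h
    · positivity
    -- A nonzero `k n` forces the maximum in `c n` to be its first, positive argument.
    · have h1 : 0 < n * c n := by
        by_contra hcon
        exact h (Nat.floor_of_nonpos (not_lt.1 hcon))
      have h2 : 0 < c n := pos_of_mul_pos_right h1 (Nat.cast_nonneg n)
      have h3 : c n * Real.log q = condEntropy J - (L' + 1) * tolerance n := by
        have h4 : 0 < max (condEntropy J - (L' + 1) * tolerance n) 0 := by
          by_contra hcon
          exact absurd h2 (not_lt.2 (div_nonpos_of_nonpos_of_nonneg (not_lt.1 hcon) hlog.le))
        have h5 : 0 < condEntropy J - (L' + 1) * tolerance n := by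
          rcases lt_max_iff.1 h4 with h | h
          · exact h
          · exact absurd h (lt_irrefl _)
        simp only [c]
        rw [div_mul_cancel₀ _ hlog.ne', max_eq_left h5.le]
      have h4 : (q : ℝ) ^ k n ≤
          Real.exp (n * (condEntropy J - (L' + 1) * tolerance n)) := by
        rw [pow_eq_exp_mul_log, Real.exp_le_exp, ← h3, ← mul_assoc]
        exact mul_le_mul_of_nonneg_right (Nat.floor_le h1.le) hlog.le
      rw [div_le_iff₀ (by positivity)]
      calc _ ≤ q * Real.exp (n * (condEntropy J - (L' + 1) * tolerance n)) := by gcongr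
        _ = q * (Real.exp (-(n * tolerance n)) *
            Real.exp (n * (condEntropy J - tolerance n * L'))) := by
            rw [← Real.exp_add]
            ring_nf
        _ = _ := by ring
  have hcol : ∀ n : ℕ, (({u | IsTypical p (Fintype.card X * tolerance n) u} :
      Set (Fin n → ZMod q)).ncard : ℝ) / (q : ℝ) ^ (k n + (k' n - k n)) ≤
      Real.exp (-(n * tolerance n)) := by
    intro n
    have h1 := ncard_typical_le (n := n) hp (Fintype.card X * tolerance n)
    have h2 : Real.exp (n * (entropy p + (L + 1) * tolerance n)) ≤
        (q : ℝ) ^ (k n + (k' n - k n)) := by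
      rw [pow_eq_exp_mul_log, Real.exp_le_exp, add_tsub_eq_max]
      have h3 : (n : ℝ) * c' n ≤ (max (k n) (k' n) : ℕ) :=
        (Nat.le_ceil _).trans (Nat.cast_le.2 (le_max_right _ _))
      calc _ = n * c' n * Real.log q := by
            simp only [c']
            field_simp
        _ ≤ _ := mul_le_mul_of_nonneg_right h3 hlog.le
    rw [div_le_iff₀ (by positivity)]
    refine h1.trans (le_trans (le_of_eq ?_) (mul_le_mul_of_nonneg_left h2 (Real.exp_pos _).le))
    rw [← Real.exp_add, hL]
    ring_nf
  have hB : Tendsto (fun n : ℕ =>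
      2 * blockProb J {z : Fin n → X × ZMod q | IsTypical J (tolerance n) z}ᶜ +
        2 * q * Real.exp (-(n * tolerance n)) + 2 * Real.exp (-(n * tolerance n))) atTop
      (𝓝 0) := by
    have h := (((tendsto_blockProb_not_typical hJ).const_mul 2).add
      (tendsto_exp_neg_mul_tolerance.const_mul (2 * (q : ℝ)))).add
      (tendsto_exp_neg_mul_tolerance.const_mul 2)
    simpa using h
  have hev := eventually_zero_not_typical hnr (Fintype.card X)
  refine ⟨C, T, ?_, ?_, ?_, ?_⟩
  · simpa only [hk] using hlimk
  · have h := hlimk.max hlimk'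
    rw [max_eq_right hle] at h
    refine h.congr fun n => ?_
    rw [hk2, ← max_mul_of_nonneg _ _ hlog.le, max_div_div_right (Nat.cast_nonneg n), Nat.cast_max]
  · refine tendsto_of_tendsto_of_tendsto_of_le_of_le' tendsto_const_nhds hB
      (Eventually.of_forall fun n => blockProb_nonneg hP.1 _) ?_
    filter_upwards [hev] with n hn
    have h1 := hCT n hn
    have h2 := blockProb_nonneg hp.1 {z : Fin n → ZMod q | ∃ u, u ≠ z ∧
          IsTypical p (Fintype.card X * tolerance n) u ∧
            (C n).H₂.mulVec u = (C n).H₂.mulVec z}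
    linarith [hcov n, hcol n]
  · refine tendsto_of_tendsto_of_tendsto_of_le_of_le' tendsto_const_nhds hB
      (Eventually.of_forall fun n => blockProb_nonneg hp.1 _) ?_
    filter_upwards [hev] with n hn
    have h1 := hCT n hn
    have h2 := blockProb_nonneg hP.1 {x : Fin n → X |
          IsTypical J (tolerance n) (fun i => (x i, (T n).quantize x i)) ∧
            (T n).decoded x = (T n).quantize x}ᶜ
    linarith [hcov n, hcol n]

end Asymptotics

/-! ### Embedding the reconstruction alphabet in `ZMod q`. -/

section Relabel

variable {X Y Z : Type*} [Fintype Y] [DecidableEq Z]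

theorem relabelSnd_joint (e : Y → Z) (P : X → ℝ) (W : X → Y → ℝ) :
    relabelSnd e (joint P W) = joint P fun x z => ∑ b, if e b = z then W x b else 0 := by
  funext z
  simp only [relabelSnd, joint, Finset.mul_sum, mul_ite, mul_zero]

theorem relabel_mem_stdSimplex [Fintype Z] (e : Y → Z) {w : Y → ℝ} (hw : w ∈ stdSimplex ℝ Y) :
    (fun z => ∑ b, if e b = z then w b else 0) ∈ stdSimplex ℝ Z := by
  refine ⟨fun z => Finset.sum_nonneg fun b _ => ?_, ?_⟩
  · split_ifs
    exacts [hw.1 b, le_rfl]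
  · rw [Finset.sum_comm, ← hw.2]
    simp

variable {e : Y → Z} {P : X → ℝ} {W : X → Y → ℝ}

theorem relabelSnd_apply (he : Function.Injective e) (J : X × Y → ℝ) (a : X) (b : Y) :
    relabelSnd e J (a, e b) = J (a, b) := by
  refine (Finset.sum_eq_single b (fun c _ hc => if_neg fun h => hc (he h)) fun h => ?_).trans
    (if_pos rfl)
  exact absurd (Finset.mem_univ b) h

theorem relabelSnd_of_notMem (J : X × Y → ℝ) (a : X) {z : Z} (hz : z ∉ Set.range e) :
    relabelSnd e J (a, z) = 0 :=
  Finset.sum_eq_zero fun b _ => if_neg fun h => hz ⟨b, h⟩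

variable [Fintype Z]

theorem sum_relabelSnd_mul (he : Function.Injective e) (J : X × Y → ℝ) (a : X) (F : Z → ℝ) :
    ∑ z, relabelSnd e J (a, z) * F z = ∑ b, J (a, b) * F (e b) := by
  refine (Fintype.sum_of_injective e he _ _ (fun z hz => ?_) fun b => ?_).symm
  · rw [relabelSnd_of_notMem J a hz, zero_mul]
  · rw [relabelSnd_apply he]

theorem margFst_relabelSnd (he : Function.Injective e) (J : X × Y → ℝ) :
    margFst (relabelSnd e J) = margFst J := by
  funext a
  simpa [margFst] using sum_relabelSnd_mul he J a fun _ => 1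

variable [Fintype X]

theorem condEntropy_relabelSnd (he : Function.Injective e) (J : X × Y → ℝ) :
    condEntropy (relabelSnd e J) = condEntropy J := by
  simp only [condEntropy, margFst_relabelSnd he]
  refine Finset.sum_congr rfl fun a _ => ?_
  refine (Fintype.sum_of_injective e he _ _ (fun z hz => ?_) fun b => ?_).symm
  · rw [relabelSnd_of_notMem J a hz, zero_mul, neg_zero]
  · rw [relabelSnd_apply he]

theorem entropy_margSnd_relabelSnd (he : Function.Injective e) (J : X × Y → ℝ) :
    entropy (margSnd (relabelSnd e J)) = entropy (margSnd J) := by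
  refine (Fintype.sum_of_injective e he _ _ (fun z hz => ?_) fun b => ?_).symm
  · simp [margSnd, relabelSnd_of_notMem J _ hz]
  · simp [margSnd, relabelSnd_apply he]

theorem exists_injective_nonzero {Y : Type*} [Fintype Y] {q : ℕ} [Fact q.Prime] (h : Fintype.card Y ≤ q) (y : Y) :
    ∃ e : Y → ZMod q, Function.Injective e ∧ e y ≠ 0 := by
  obtain ⟨f⟩ := Function.Embedding.nonempty_of_card_le (α := Y) (β := ZMod q)
    (by rwa [ZMod.card])
  -- The transposition moves the image of `y` to `1`.
  refine ⟨fun b => Equiv.swap (f y) 1 (f b), (Equiv.injective _).comp f.injective, ?_⟩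
  simp

end Relabel

/-! ### Channel codes without side information. -/

section UnitSideInformation

variable {α : Type*} {p : α → ℝ} {n : ℕ}

theorem isTypical_unit_iff {δ : ℝ} {z : Fin n → α × Unit} :
    IsTypical (fun z : α × Unit => p z.1) δ z ↔ IsTypical p δ fun i => (z i).1 := by
  have h : ∀ i a, z i = (a, ()) ↔ (z i).1 = a := fun i a => by simp [Prod.ext_iff]
  constructor
  · intro hz a
    have := hz (a, ())
    simpa only [h, ne_eq] using this
  · rintro hz ⟨a, _⟩
    simpa only [h, ne_eq] using hz a

theorem blockProb_unit [Fintype α] (B : Set (Fin n → α)) :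
    blockProb (fun z : α × Unit => p z.1) {z : Fin n → α × Unit | (fun i => (z i).1) ∈ B} =
      blockProb p B := by
  refine Fintype.sum_equiv ((Equiv.refl (Fin n)).arrowCongr (Equiv.prodPUnit α)) _ _ fun z => rfl

variable {q : ℕ} {p : ZMod q → ℝ}

theorem confusableSet_unit {δ : ℝ} {k : ℕ} (H : Matrix (Fin k) (Fin n) (ZMod q)) :
    confusableSet (fun z : ZMod q × Unit => p z.1) δ H =
      {z : Fin n → ZMod q × Unit | (fun i => (z i).1) ∈
        {z : Fin n → ZMod q | ∃ u, u ≠ z ∧ IsTypical p δ u ∧ H.mulVec u = H.mulVec z}} := by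
  ext z
  simp only [confusableSet, isTypical_unit_iff, Set.mem_ofPred_eq]

/-- Typicality together with the absence of confusion yields a good channel code. -/
theorem isGoodChannelCode_unit [Fact q.Prime] (hp : p ∈ stdSimplex ℝ (ZMod q)) (hnr : NonRedundant p)
    {k : ℕ → ℕ} (H : ∀ n, Matrix (Fin (k n)) (Fin n) (ZMod q)) {c : ℝ} (hc : 1 ≤ c)
    (hconf : Tendsto (fun n : ℕ => blockProb p {z : Fin n → ZMod q | ∃ u, u ≠ z ∧
      IsTypical p (c * tolerance n) u ∧ (H n).mulVec u = (H n).mulVec z}) atTop (𝓝 0)) :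
    IsGoodChannelCode (fun z : ZMod q × Unit => p z.1) H := by
  classical
  refine ⟨?_, fun ε hε => ?_⟩
  · obtain ⟨u, hu, hpu⟩ := hnr
    exact ⟨u, hu, by simpa [margFst] using hpu⟩
  have htol : Tendsto (fun n => c * tolerance n) atTop (𝓝 0) := by
    simpa using tendsto_tolerance.const_mul c
  have hε2 : 0 < ε / 2 := half_pos hε
  filter_upwards [hconf.eventually_lt_const hε2, htol.eventually_lt_const hε,
    (tendsto_blockProb_not_typical hp).eventually_lt_const hε2, eventually_gt_atTop 0]
    with n h1 h2 h3 h4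
  set δ := c * tolerance n with hδ
  have hle : tolerance n ≤ δ := le_mul_of_one_le_left (tolerance_nonneg n) hc
  have hsub : {x : Fin n → ZMod q | IsTypical p (tolerance n) x} ⊆
      {x : Fin n → ZMod q | IsTypical p δ x} := fun x hx => IsTypical.mono hle hx
  set B : Set (Fin n → ZMod q) := {z | ∃ u, u ≠ z ∧
      IsTypical p δ u ∧ (H n).mulVec u = (H n).mulVec z} with hB
  rw [blockProb_compl hp] at h3
  have h5 := blockProb_mono hp.1 hsub
  refine ⟨⟨δ, (tolerance_pos h4).trans_le hle, h2.le, ?_, ?_⟩, ?_⟩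
  · simp only [isTypical_unit_iff]
    have := blockProb_unit (p := p) {x : Fin n → ZMod q | IsTypical p δ x}
    simp only [Set.mem_ofPred_eq] at this
    rw [this]
    linarith
  · rw [confusableSet_unit, blockProb_unit]
    linarith
  -- Decode to any typical word with the given syndrome; this fails only if `z` is atypical or
  -- confusable.
  · let ψ : (Fin (k n) → ZMod q) → Fin n → ZMod q := fun s =>
      if h : ∃ u, IsTypical p δ u ∧ (H n).mulVec u = s then h.choose else 0
    refine ⟨fun s _ => ψ s, ?_⟩
    have h6 := blockProb_unit (p := p) {z : Fin n → ZMod q | ψ ((H n).mulVec z) = z}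
    simp only [Set.mem_ofPred_eq] at h6
    rw [h6]
    have h7 : {z : Fin n → ZMod q | ψ ((H n).mulVec z) = z}ᶜ ⊆
        {x : Fin n → ZMod q | IsTypical p δ x}ᶜ ∪ B := by
      intro z hz
      by_contra hcon
      rw [Set.mem_union, not_or, Set.mem_compl_iff, not_not] at hcon
      refine hz ?_
      have h : ∃ u, IsTypical p δ u ∧ (H n).mulVec u = (H n).mulVec z := ⟨z, hcon.1, rfl⟩
      by_contra hne
      rw [Set.mem_ofPred_eq] at hne
      simp only [ψ, dif_pos h] at hne
      exact hcon.2 ⟨h.choose, hne, h.choose_spec.1, h.choose_spec.2⟩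
    have h8 := (blockProb_mono hp.1 h7).trans (blockProb_union_le hp.1 _ _)
    rw [blockProb_compl hp, blockProb_compl hp] at h8
    linarith

end UnitSideInformation

/-! ### From joint typicality to expected distortion. -/

section Distortion

variable {X Z : Type*} [Fintype X] [Fintype Z]

theorem NestedCodes.IsTypical.average_le {α : Type*} [Fintype α] {p : α → ℝ} {δ : ℝ} {n : ℕ}
    (hn : 0 < n) {x : Fin n → α} (hx : IsTypical p δ x) {f : α → ℝ} (hf : ∀ a, 0 ≤ f a) :
    (∑ i, f (x i)) / n ≤ ∑ a, p a * f a + δ * ∑ a, f a := by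
  have h := (abs_le.1 (hx.abs_sum_sub_le f)).2
  simp only [abs_of_nonneg (hf _)] at h
  rw [div_le_iff₀ (Nat.cast_pos.2 hn)]
  linarith

/-- Joint typicality with high probability bounds the expected distortion. -/
theorem sum_distortion_le {P : X → ℝ} (hP : P ∈ stdSimplex ℝ X) {J : X × Z → ℝ}
    (hJ : ∀ z, 0 ≤ J z) {f : X × Z → ℝ} (hf : ∀ z, 0 ≤ f z) {δ : ℝ} (hδ : 0 ≤ δ)
    {n : ℕ} (hn : 0 < n) (v : (Fin n → X) → Fin n → Z) (A : Set (Fin n → X))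
    (hA : ∀ x ∈ A, IsTypical J δ fun i => (x i, v x i)) :
    ∑ x : Fin n → X, (∏ i, P (x i)) * ((∑ i, f (x i, v x i)) / n) ≤
      ∑ z, J z * f z + (δ + blockProb P Aᶜ) * ∑ z, f z := by
  classical
  set S := ∑ z, f z with hS
  have hS0 : 0 ≤ S := Finset.sum_nonneg fun z _ => hf z
  set E := ∑ z, J z * f z with hE
  have hE0 : 0 ≤ E := Finset.sum_nonneg fun z _ => mul_nonneg (hJ z) (hf z)
  have hn' : (0 : ℝ) < n := Nat.cast_pos.2 hn
  -- Off `A` the average is bounded crudely by `S`, which dominates every value of `f`.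
  have hpt : ∀ x : Fin n → X, (∑ i, f (x i, v x i)) / n ≤
      (E + δ * S) + (if x ∈ Aᶜ then 1 else 0) * S := by
    intro x
    by_cases hx : x ∈ A
    · rw [if_neg (by simpa using hx), zero_mul, add_zero]
      exact (hA x hx).average_le hn hf
    · rw [if_pos (by simpa using hx), one_mul]
      have h1 : (∑ i, f (x i, v x i)) / n ≤ S := by
        rw [div_le_iff₀ hn']
        calc _ ≤ ∑ _i : Fin n, S := Finset.sum_le_sum fun i _ =>
              Finset.single_le_sum (fun z _ => hf z) (Finset.mem_univ _)
          _ = _ := by simp [mul_comm]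
      have h2 : 0 ≤ E + δ * S := by positivity
      linarith
  calc _ ≤ ∑ x : Fin n → X, (∏ i, P (x i)) *
        ((E + δ * S) + (if x ∈ Aᶜ then 1 else 0) * S) :=
        Finset.sum_le_sum fun x _ => mul_le_mul_of_nonneg_left (hpt x) (prod_law_nonneg hP.1 x)
    _ = _ := by
        simp only [mul_add, Finset.sum_add_distrib, ← Finset.sum_mul, ← mul_assoc,
          sum_prod_law hP n]
        rw [blockProb_eq_sum_ite]
        have : ∀ x : Fin n → X, (∏ i, P (x i)) * (if x ∈ Aᶜ then (1 : ℝ) else 0) =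
          (∏ i, P (x i)) * @ite ℝ (x ∈ Aᶜ) (Classical.propDecidable _) 1 0 := fun x => by congr
        simp only [this]
        ring

end Distortion

/-! ### Achievability of the rate-distortion function. -/

theorem corollary4 {X Y : Type*} [Fintype X] [Fintype Y]
    (P : X → ℝ) (hP : P ∈ stdSimplex ℝ X)
    (d : X → Y → ℝ) (hd : ∀ x y, 0 ≤ d x y)
    (D : ℝ) (hD : ∃ W, IsFeasible P d D W) :
    IsLeast (feasibleRates P d D) (rateDistortion P d D) ∧
    ∀ W : X → Y → ℝ, IsFeasible P d D W →
      mutualInfo (joint P W) = rateDistortion P d D →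
      ∀ (q : ℕ) [Fact q.Prime], Fintype.card Y ≤ q →
      ∃ (e : Y → ZMod q) (g : ZMod q → Y), Function.LeftInverse g e ∧
      ∃ (C : ∀ n : ℕ, NestedLinearCode q n) (T : ∀ n : ℕ, (C n).Scheme X),
        -- the fine codes form a good source code for the pair (source, reconstruction)
        IsGoodSourceCode (relabelSnd e (joint P W)) (fun n => (C n).H₁) ∧
        Tendsto (fun n : ℕ => ((C n).k₁ : ℝ) / n * Real.log q) atTop
          (𝓝 (condEntropy (joint P W))) ∧
        -- the coarse codes form a good channel code, with trivial side information
        IsGoodChannelCode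
          (fun z : ZMod q × Unit => margSnd (relabelSnd e (joint P W)) z.1)
          (fun n => (C n).H₂) ∧
        Tendsto (fun n : ℕ => ((C n).k₂ : ℝ) / n * Real.log q) atTop
          (𝓝 (entropy (margSnd (joint P W)))) ∧
        -- joint typicality encoding and recovery of the quantized sequence by the decoder
        (∀ ε : ℝ, 0 < ε → ∀ᶠ n in atTop,
          1 - ε ≤ blockProb P {x : Fin n → X |
            IsTypical (relabelSnd e (joint P W)) ε (fun i => (x i, (T n).quantize x i)) ∧
            (T n).decoded x = (T n).quantize x}) ∧
        -- the rate-distortion bound is achieved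
        Tendsto (fun n : ℕ => (C n).rate) atTop (𝓝 (rateDistortion P d D)) ∧
        ∀ ε : ℝ, 0 < ε → ∀ᶠ n in atTop,
          (T n).expectedDistortion P d g ≤ D + ε := by
  classical
  refine ⟨isLeast_rateDistortion hP d D hD, fun W hW hRD q _ hq => ?_⟩
  have hJ := joint_mem_stdSimplex hP hW.1
  have hpY := margSnd_mem_stdSimplex hJ
  -- Sending this letter to a nonzero element makes the embedded law nonredundant.
  obtain ⟨y, hy⟩ : ∃ y, 0 < margSnd (joint P W) y := by
    by_contra! hcon
    have h := Finset.sum_nonpos fun y (_ : y ∈ Finset.univ) => hcon y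
    rw [hpY.2] at h
    exact absurd h (not_le.2 one_pos)
  obtain ⟨e, he, hey⟩ := exists_injective_nonzero hq y
  have : Nonempty Y := ⟨y⟩
  have hg : Function.LeftInverse (Function.invFun e) e := Function.leftInverse_invFun he
  let W' : X → ZMod q → ℝ := fun x z => ∑ b, if e b = z then W x b else 0
  have hW' : ∀ x, W' x ∈ stdSimplex ℝ (ZMod q) := fun x => relabel_mem_stdSimplex e (hW.1 x)
  have hrel : relabelSnd e (joint P W) = joint P W' := relabelSnd_joint e P W
  have hJ' := joint_mem_stdSimplex hP hW'
  have hp := margSnd_mem_stdSimplex hJ'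
  have hnr : NonRedundant (margSnd (joint P W')) := by
    refine ⟨e y, hey, ?_⟩
    rw [← hrel]
    simpa only [margSnd, relabelSnd_apply he] using hy
  have hcE : condEntropy (joint P W') = condEntropy (joint P W) := by
    rw [← hrel, condEntropy_relabelSnd he]
  have hE : entropy (margSnd (joint P W')) = entropy (margSnd (joint P W)) := by
    rw [← hrel, entropy_margSnd_relabelSnd he]
  obtain ⟨C, T, hk₁, hk₂, hgood, hconf⟩ := exists_scheme_sequence hP hW' hnr
  rw [hcE] at hk₁
  rw [hE] at hk₂
  have hXne : Nonempty X := by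
    by_contra hcon
    rw [not_nonempty_iff] at hcon
    simpa using hP.2
  have hcard : (1 : ℝ) ≤ Fintype.card X := Nat.one_le_cast.2 Fintype.card_pos
  have hjoint : ∀ ε : ℝ, 0 < ε → ∀ᶠ n in atTop,
      1 - ε ≤ blockProb P {x : Fin n → X |
        IsTypical (joint P W') ε (fun i => (x i, (T n).quantize x i)) ∧
        (T n).decoded x = (T n).quantize x} := by
    intro ε hε
    filter_upwards [hgood.eventually_lt_const hε, tendsto_tolerance.eventually_lt_const hε]
      with n h1 h2
    rw [blockProb_compl hP] at h1
    refine le_trans (by linarith) (blockProb_mono hP.1 ?_)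
    exact fun x hx => ⟨IsTypical.mono h2.le hx.1, hx.2⟩
  refine ⟨e, Function.invFun e, hg, C, T, ?_, hk₁, ?_, hk₂, ?_, ?_, ?_⟩
  · rw [hrel]
    refine ⟨hnr, fun ε hε => ?_⟩
    filter_upwards [hjoint ε hε] with n hn
    rw [margFst_joint hW']
    refine hn.trans (blockProb_mono hP.1 ?_)
    exact fun x hx => ⟨(T n).quantize x, (T n).quantize_mem x, hx.1⟩
  · rw [hrel]
    exact isGoodChannelCode_unit hp hnr _ hcard hconf
  · rw [hrel]
    exact hjoint
  · rw [← hRD, mutualInfo_eq hJ.1]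
    refine (hk₂.sub hk₁).congr fun n => ?_
    rw [NestedLinearCode.rate, sub_div, sub_mul]
  · intro ε hε
    let f : X × ZMod q → ℝ := fun z => d z.1 (Function.invFun e z.2)
    have hf : ∀ z, 0 ≤ f z := fun z => hd _ _
    -- The embedded law is supported on the range of `e`, where `Function.invFun e` undoes `e`; its
    -- values elsewhere do not affect this mean.
    have hmean : ∑ z, joint P W' z * f z ≤ D := by
      refine le_trans (le_of_eq ?_) hW.2
      rw [Fintype.sum_prod_type, ← hrel]
      refine Finset.sum_congr rfl fun x _ => ?_
      have h := sum_relabelSnd_mul he (joint P W) x fun z => f (x, z)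
      simpa only [f, hg _] using h
    have hlim : Tendsto (fun n : ℕ => (tolerance n + blockProb P {x : Fin n → X |
        IsTypical (joint P W') (tolerance n) (fun i => (x i, (T n).quantize x i)) ∧
        (T n).decoded x = (T n).quantize x}ᶜ) * ∑ z, f z) atTop (𝓝 0) := by
      simpa using (tendsto_tolerance.add hgood).mul_const (∑ z, f z)
    filter_upwards [hlim.eventually_lt_const hε, eventually_gt_atTop 0] with n h1 h2
    have h3 := sum_distortion_le hP hJ'.1 hf (tolerance_nonneg n) h2 (T n).decoded
      {x : Fin n → X |
        IsTypical (joint P W') (tolerance n) (fun i => (x i, (T n).quantize x i)) ∧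
        (T n).decoded x = (T n).quantize x}
      (fun x hx => by rw [hx.2]; exact hx.1)
    change ∑ x : Fin n → X, (∏ i, P (x i)) * ((∑ i, f (x i, (T n).decoded x i)) / n) ≤ D + ε
    linarith
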